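/- **Setting.** Let $K\ge 1$. Items and positions are both $[K]=\{1,\dots,K\}$, and a list $\mathcal R$ is a permutation of $[K]$: $\mathcal R(k)$ is the item at position $k$, and $\mathcal R^{-1}(i)$ is the position of item $i$. Put $\mathcal R^*=(1,\dots,K)$. A *stochastic click bandit* is given by the law of a random pair $(A,X)$, where $A\in\{0,1\}^{K}$ is an attraction vector and $X(\mathcal R,k)\in\{0,1\}$ (for all lists $\mathcal R$ and positions $k$) are examination indicators, such that $\mathbb E[X(\mathcal R,k)A(\mathcal R(k))]=\chi(\mathcal R,k)\,\alpha(\mathcal R(k))$ for all $\mathcal R,k$, where $\alpha=\mathbb E[A]$ and $\chi=\mathbb E[X]$. (In particular, $A$ and $X$ may be independent.) At each time $t=1,2,\dots$ an independent copy $(A_t,X_t)$ is drawn; when list $\mathcal R_t$ is displayed, the clicks $c_t(k)=X_t(\mathcal R_t,k)A_t(\mathcal R_t(k))$ are observed. Put $r(\mathcal R)=\sum_{k=1}^K\chi(\mathcal R,k)\alpha(\mathcal R(k))$ and $R(n)=\sum_{t=1}^n\mathbb E\big[\max_{\mathcal R}r(\mathcal R)-r(\mathcal R_t)\big]$. **Assumptions.**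 For all lists $\mathcal R,\mathcal R'$ and all positions $k$ and $\ell$, with $k<\ell$ in A3 and A4: - A1. $r(\mathcal R)\le r(\mathcal R^*)$. - A2. If $\{\mathcal R(1),\dots,\mathcal R(k-1)\}=\{\mathcal R'(1),\dots,\mathcal R'(k-1)\}$, then $\chi(\mathcal R,k)=\chi(\mathcal R',k)$. - A3. $\chi(\mathcal R,k)\ge\chi(\mathcal R,\ell)$. - A4. If $\mathcal R'$ is $\mathcal R$ with the items at positions $k$ and $\ell$ exchanged and $\alpha(\mathcal R(k))\le\alpha(\mathcal R(\ell))$, then $\chi(\mathcal R,\ell)\ge\chi(\mathcal R',\ell)$. - A5. $\chi(\mathcal R,k)\ge\chi(\mathcal R^*,k)$. Moreover $\alpha(1)>\dots>\alpha(K)>0$. Put $\chi_{\max}=\chi(\mathcal R^*,1)$ and $\chi_{\min}=\chi(\mathcal R^*,K)$, and assume $\chi_{\min}>0$. Put $\Delta_{\min}=\min_{1\le k\le K-1}(\alpha(k)-\alpha(k+1))$. **BubbleRank** (initial base list $\mathcal R_0$, parameter $\delta\in(0,1)$). Start with $s_0(i,j)=n_0(i,j)=0$ for all items $i,j$, and with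 base list $\bar{\mathcal R}_1=\mathcal R_0$. Let $\theta_t(i,j)=2\sqrt{n_t(i,j)\log(1/\delta)}$. At time $t$, let $h=t\bmod 2$ and consider the position pairs $(2k-1+h,\,2k+h)$ for $1\le k\le\lfloor (K-h)/2\rfloor$. 1. *Display.* $\mathcal R_t$ is obtained from $\bar{\mathcal R}_t$ as follows. For each of these pairs, with items $i$ (upper) and $j$ (lower) in $\bar{\mathcal R}_t$, if $s_{t-1}(i,j)\le\theta_{t-1}(i,j)$, exchange the two items with probability $1/2$, using independent fair coins. 2. *Update.* Observe the clicks $c_t$ on $\mathcal R_t$ and set $s_t=s_{t-1}$, $n_t=n_{t-1}$. Then, for each of these pairs, with items $i$ and $j$ in $\mathcal R_t$, if exactly one of the two is clicked, add the click on $i$ minus the click on $j$ to $s_t(i,j)$, add the opposite number to $s_t(j,i)$, and increase $n_t(i,j)$ and $n_t(j,i)$ by $1$. 3. *New base list.* Start from $\bar{\mathcal R}_{t+1}=\bar{\mathcal R}_t$. For $k=1,\dots,K-1$ in this order, let $i$ and $j$ be the items currently at positions $k$ and $k+1$ of $\bar{\mathcal R}_{t+1}$, and exchange them if $s_t(j,i)>\theta_t(j,i)$.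 **Theorem.** For every such bandit, every initial base list $\mathcal R_0$, every $\delta\in(0,1)$ and every $n\ge 0$, the expected $n$-step regret of BubbleRank satisfies $$R(n)\le 180\,K\,\frac{\chi_{\max}}{\chi_{\min}}\cdot\frac{K-1+2|\mathcal V_0|}{\Delta_{\min}}\,\log(1/\delta)+\delta^{1/2}K^3n^2,$$ where $\mathcal V_0=\{(i,j): i<j,\ \mathcal R_0^{-1}(i)>\mathcal R_0^{-1}(j)\}$. (For $K=1$ the first term is read as $0$.) -/

import Mathlib

open MeasureTheory ProbabilityTheory

/-- Items and positions are both indexed by `Fin K` (counted from `0`).  A ranked list of all `K`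
items is a permutation `R`: `R k` is the item at position `k`, `R.symm i` the position of item
`i`.  The list `1` is the list `(1, …, K)`. -/
abbrev RankedList (K : ℕ) : Type := Equiv.Perm (Fin K)

/-- Binary attraction vectors. -/
abbrev AttractionVec (K : ℕ) : Type := Fin K → Bool

/-- Binary examination matrices, with entries indexed by lists and positions. -/
abbrev ExaminationMat (K : ℕ) : Type := RankedList K → Fin K → Bool

/-- A stochastic click bandit with `K` items and `K` positions: the law of one pair
`(A, X)` of an attraction vector and an examination matrix, such that the attraction of any item
is independent of the examination of its position (nothing else about the joint law is
required). -/
structure ClickBandit (K : ℕ) where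
  law : Measure (AttractionVec K × ExaminationMat K)
  isProb : IsProbabilityMeasure law
  factor : ∀ (R : RankedList K) (k : Fin K),
    law.real {w | w.1 (R k) = true ∧ w.2 R k = true}
      = law.real {w | w.2 R k = true} * law.real {w | w.1 (R k) = true}

namespace ClickBandit

variable {K : ℕ}

instance (B : ClickBandit K) : IsProbabilityMeasure B.law := B.isProb

/-- The click bandit in which the attraction vector and the examination matrix are independent,
with laws `Pα` and `Pχ`. -/
noncomputable def ofProd (Pα : Measure (AttractionVec K)) (Pχ : Measure (ExaminationMat K))
    [IsProbabilityMeasure Pα] [IsProbabilityMeasure Pχ] : ClickBandit K where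
  law := Pα.prod Pχ
  isProb := inferInstance
  factor := by
    intro R k
    have h1 : {w : AttractionVec K × ExaminationMat K | w.1 (R k) = true ∧ w.2 R k = true}
        = {a : AttractionVec K | a (R k) = true} ×ˢ {x : ExaminationMat K | x R k = true} := by
      ext w; simp
    have h2 : {w : AttractionVec K × ExaminationMat K | w.2 R k = true}
        = Set.univ ×ˢ {x : ExaminationMat K | x R k = true} := by
      ext w; simp
    have h3 : {w : AttractionVec K × ExaminationMat K | w.1 (R k) = true}
        = {a : AttractionVec K | a (R k) = true} ×ˢ Set.univ := by
      ext w; simp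
    rw [h1, h2, h3, measureReal_prod_prod, measureReal_prod_prod, measureReal_prod_prod]
    simp [mul_comm]

/-- Attraction probability `α(i)` of item `i`. -/
noncomputable def α (B : ClickBandit K) (i : Fin K) : ℝ :=
  B.law.real {w | w.1 i = true}

/-- Examination probability `χ(R, k)` of position `k` in list `R`. -/
noncomputable def χ (B : ClickBandit K) (R : RankedList K) (k : Fin K) : ℝ :=
  B.law.real {w | w.2 R k = true}

/-- Expected reward (number of clicks) `r(R, α, χ)` of list `R`. -/
noncomputable def reward (B : ClickBandit K) (R : RankedList K) : ℝ :=
  ∑ k, B.χ R k * B.α (R k)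

/-- The assumptions on the click bandit.  For A4, `R * Equiv.swap k l` is the list `R` with the
items at positions `k` and `l` exchanged; only the implication from left to right is assumed,
since the converse fails in the position-based model as soon as the attraction probabilities
differ. -/
structure Assumptions (B : ClickBandit K) : Prop where
  A1 : ∀ R : RankedList K, B.reward R ≤ B.reward 1
  A2 : ∀ (R R' : RankedList K) (k : Fin K),
    R '' {p | p < k} = R' '' {p | p < k} → B.χ R k = B.χ R' k
  A3 : ∀ (R : RankedList K) (k l : Fin K), k < l → B.χ R l ≤ B.χ R k
  A4 : ∀ (R : RankedList K) (k l : Fin K), k < l →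
    B.α (R k) ≤ B.α (R l) → B.χ (R * Equiv.swap k l) l ≤ B.χ R l
  A5 : ∀ (R : RankedList K) (k : Fin K), B.χ 1 k ≤ B.χ R k

end ClickBandit

namespace BubbleRank

variable {K : ℕ}

/-- The upper position of the `p`-th pair of neighbouring positions. -/
def lo (p : Fin (K - 1)) : Fin K := ⟨p, by omega⟩

/-- The lower position of the `p`-th pair of neighbouring positions. -/
def hi (p : Fin (K - 1)) : Fin K := ⟨p + 1, by omega⟩

/-- The memory of the algorithm after a step: the statistics `s` and `n`, and the next
base list. -/
structure State (K : ℕ) where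
  s : Fin K → Fin K → ℤ
  n : Fin K → Fin K → ℕ
  base : RankedList K

/-- The initial memory, with initial base list `R₀`. -/
def init (R₀ : RankedList K) : State K where
  s := fun _ _ => 0
  n := fun _ _ => 0
  base := R₀

/-- The belief that `i` is more attractive than `j` is above its threshold:
`s(i, j) > 2 √(n(i, j) log(1 / δ))`. -/
def Confident (δ : ℝ) (s : Fin K → Fin K → ℤ) (n : Fin K → Fin K → ℕ) (i j : Fin K) : Prop :=
  2 * √((n i j : ℝ) * Real.log (1 / δ)) < (s i j : ℝ)

/-- The `p`-th pair of neighbouring positions is one of the pairs handled at time `t`.  With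
`h = t mod 2` and positions counted from `1`, these are the pairs `(2k - 1 + h, 2k + h)` for
`k = 1, …, ⌊(K - h) / 2⌋`; counted from `0`, the upper position is congruent to `h` mod `2`. -/
def Slot (t : ℕ) (p : Fin (K - 1)) : Prop := (p : ℕ) % 2 = t % 2

open Classical in
/-- The list displayed at time `t`: the neighbours in each handled pair are exchanged if the
corresponding coin says so, unless the upper item is confidently more attractive. -/
noncomputable def display (δ : ℝ) (t : ℕ) (S : State K) (coin : Fin (K - 1) → Bool) :
    RankedList K :=
  (List.finRange (K - 1)).foldl
    (fun R p =>
      if Slot t p ∧ ¬ Confident δ S.s S.n (R (lo p)) (R (hi p)) ∧ coin p = true then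
        R * Equiv.swap (lo p) (hi p)
      else R)
    S.base

/-- The clicks on the displayed list: a position is clicked iff it is examined and its item is
attractive. -/
def click (A : AttractionVec K) (X : ExaminationMat K) (R : RankedList K) (k : Fin K) : ℤ :=
  if X R k = true ∧ A (R k) = true then 1 else 0

/-- Positions `a` and `b` form one of the pairs handled at time `t` (in either order). -/
def Paired (t : ℕ) (a b : Fin K) : Prop :=
  ∃ p : Fin (K - 1), Slot t p ∧ ((a = lo p ∧ b = hi p) ∨ (a = hi p ∧ b = lo p))

open Classical in
/-- Update of `s` after clicks `c` on list `R`: whenever exactly one of the items `i`, `j` of a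
handled pair is clicked, `s(i, j)` changes by the click on `i` minus the click on `j` (this
difference is `0` in the other cases). -/
noncomputable def updateS (t : ℕ) (R : RankedList K) (c : Fin K → ℤ)
    (s : Fin K → Fin K → ℤ) (i j : Fin K) : ℤ :=
  if Paired t (R.symm i) (R.symm j) then s i j + (c (R.symm i) - c (R.symm j)) else s i j

open Classical in
/-- Update of `n`: `n(i, j)` counts how often exactly one of the two items of the handled pair
was clicked. -/
noncomputable def updateN (t : ℕ) (R : RankedList K) (c : Fin K → ℤ)
    (n : Fin K → Fin K → ℕ) (i j : Fin K) : ℕ :=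
  if Paired t (R.symm i) (R.symm j) ∧ |c (R.symm i) - c (R.symm j)| = 1 then n i j + 1
  else n i j

open Classical in
/-- One pass over the base list from top to bottom: neighbours are permanently exchanged if the
lower item is confidently more attractive. -/
noncomputable def bubble (δ : ℝ) (s : Fin K → Fin K → ℤ) (n : Fin K → Fin K → ℕ)
    (R : RankedList K) : RankedList K :=
  (List.finRange (K - 1)).foldl
    (fun R p =>
      if Confident δ s n (R (hi p)) (R (lo p)) then R * Equiv.swap (lo p) (hi p) else R)
    R

/-- The randomness of one step: the attraction vector, the examination matrix, and the coins used
by the algorithm. -/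
abbrev Outcome (K : ℕ) : Type :=
  (AttractionVec K × ExaminationMat K) × (Fin (K - 1) → Bool)

/-- Step `t` of the algorithm. -/
noncomputable def step (δ : ℝ) (t : ℕ) (S : State K) (w : Outcome K) : State K :=
  let R := display δ t S w.2
  let c := click w.1.1 w.1.2 R
  let s := updateS t R c S.s
  let n := updateN t R c S.n
  { s := s, n := n, base := bubble δ s n S.base }

/-- The memory after `t` steps; `ω t` is the randomness of step `t + 1`. -/
noncomputable def stateAfter (δ : ℝ) (R₀ : RankedList K) (ω : ℕ → Outcome K) : ℕ → State K
  | 0 => init R₀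
  | t + 1 => step δ (t + 1) (stateAfter δ R₀ ω t) (ω t)

/-- The list displayed at step `t + 1`, for `t = 0, 1, …`. -/
noncomputable def displayed (δ : ℝ) (R₀ : RankedList K) (ω : ℕ → Outcome K) (t : ℕ) :
    RankedList K :=
  display δ (t + 1) (stateAfter δ R₀ ω t) (ω t).2

/-- The law of the whole experiment: the steps are i.i.d.; in each step the attraction vector and
the examination matrix follow the law of the bandit, and the coins are fair and independent of
each other and of everything else. -/
noncomputable def experiment (B : ClickBandit K) : Measure (ℕ → Outcome K) :=
  Measure.infinitePi fun _ : ℕ =>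
    B.law.prod (PMF.uniformOfFintype (Fin (K - 1) → Bool)).toMeasure

/-- The expected `n`-step regret of the algorithm, with initial base list `R₀` and
parameter `δ`. -/
noncomputable def regret (B : ClickBandit K) (δ : ℝ) (R₀ : RankedList K) (n : ℕ) : ℝ :=
  ∑ t ∈ Finset.range n,
    ∫ ω, (Finset.univ.sup' Finset.univ_nonempty B.reward - B.reward (displayed δ R₀ ω t))
      ∂(experiment B)

/-- The set of incorrectly ordered item pairs in a list. -/
def incorrectPairs (R : RankedList K) : Finset (Fin K × Fin K) :=
  Finset.univ.filter fun q => q.1 < q.2 ∧ R.symm q.2 < R.symm q.1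

/-- Maximum examination probability: first position of the list `(1, …, K)`. -/
noncomputable def χmax [NeZero K] (B : ClickBandit K) : ℝ := B.χ 1 0

/-- Minimum examination probability: last position of the list `(1, …, K)`. -/
noncomputable def χmin [NeZero K] (B : ClickBandit K) : ℝ :=
  B.χ 1 ⟨K - 1, Nat.sub_lt (NeZero.pos K) Nat.one_pos⟩

/-- Minimum gap between the attraction probabilities of consecutive items (a minimum over
`K - 1` values). -/
noncomputable def Δmin (B : ClickBandit K) : ℝ :=
  ⨅ p : Fin (K - 1), (B.α (lo p) - B.α (hi p))

end BubbleRank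

/-! The proof separates a rare failure event from an amortised count of exploration costs.

Failure means that for some i < j the wrong order, j above i, is believed with confidence (`Good`
fails). Randomising a handled pair makes the better item at least as well examined on average
(`coinMean_χ_le`), so s(i,j) drifts upwards and exp(-μ s - μ² n / 2) is a supermartingale. With μ
tuned to each possible value of the count n(i,j), the failure probability up to time n is at most δ²
K² n (`integral_not_alive_le`). On failure the regret is bounded by K n.

Before failure, every exchange in the base list removes an inversion and creates at most two new
pairs of neighbours (`bubble_improves`). Hence at most K - 1 + 2|V₀| pairs ever become neighbours.
For each such pair let ρ be its relative gap. A counted click moves s - (ρ/2) n upwards on average,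
and lack of confidence forces s - (ρ/2) n ≤ 2L/ρ with L = log(1/δ). A function of this quantity that
is the identity up to 2L/ρ and saturates beyond it is bounded by (2L + 5)/ρ, yet grows by a quarter
of the drift while the pair is undecided (`integral_evidence_step`). The potential "evidence still
missing on the pairs seen so far, plus 2C per inversion left", with C a common bound for (2L + 5)/ρ,
therefore controls the expected total gap of undecided handled pairs (`sum_integral_activeGap_le`).

Finally, one-step regret is at most K χmax times the largest loss of attraction at a position. That
loss comes from coin exchanges and from inverted neighbours in the base list; the latter are handled
now or, by parity, in the next step (`regret_step_le`). Steps around a change of the base list are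
charged to the inversion removed. -/

namespace BubbleRank

variable {K : ℕ}

/-! ### Drift inequalities for the two potentials -/

/-- A bounded concave function: the identity up to `b`, exponentially saturating above `b`. -/
noncomputable def saturate (b η w : ℝ) : ℝ :=
  if w ≤ b then w else b + (1 - Real.exp (-(η * (w - b)))) / η

lemma saturate_le {b η : ℝ} (hη : 0 < η) (w : ℝ) : saturate b η w ≤ b + 1 / η := by
  unfold saturate
  split_ifs with h
  · have : 0 < 1 / η := by positivity
    linarith
  · have := Real.exp_pos (-(η * (w - b)))
    gcongr
    linarith

lemma saturate_zero {b η : ℝ} (hb : 0 ≤ b) : saturate b η 0 = 0 := by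
  simp [saturate, hb]

/-- The exponential branch is tangent to the identity at b and lies below it everywhere. The
constant c is the slope at w, and the inequality replaces a Taylor expansion, valid for jumps of any
size across b. -/
lemma saturate_tangent {b η : ℝ} (hη : 0 < η) (w : ℝ) :
    ∃ c : ℝ, 0 ≤ c ∧ (w ≤ b → c = 1) ∧
      ∀ x, saturate b η w + c * ((1 - Real.exp (-(η * x))) / η) ≤ saturate b η (w + x) := by
  have key : ∀ z : ℝ, (1 - Real.exp (-(η * z))) / η ≤ z := fun z => by
    rw [div_le_iff₀ hη]
    have := Real.add_one_le_exp (-(η * z))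
    linarith
  by_cases hw : w ≤ b
  · refine ⟨1, zero_le_one, fun _ => rfl, fun x => ?_⟩
    unfold saturate
    rw [if_pos hw]
    split_ifs with hx
    · have := key x
      linarith
    · push Not at hx
      have h1 := key (b - w)
      have h2 : Real.exp (-(η * (w + x - b))) ≤ 1 :=
        Real.exp_le_one_iff.2 (by nlinarith)
      have h3 : Real.exp (-(η * x))
          = Real.exp (-(η * (w + x - b))) * Real.exp (-(η * (b - w))) := by
        rw [← Real.exp_add]; ring_nf
      rw [h3]
      rw [div_le_iff₀ hη] at h1
      have h5 : Real.exp (-(η * (b - w))) ≤ 1 := Real.exp_le_one_iff.2 (by nlinarith)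
      have h4 : (1 - Real.exp (-(η * (w + x - b))) * Real.exp (-(η * (b - w)))) / η
          ≤ (b - w) + (1 - Real.exp (-(η * (w + x - b)))) / η := by
        rw [div_le_iff₀ hη, add_mul, div_mul_cancel₀ _ hη.ne']
        nlinarith
      linarith
  · refine ⟨Real.exp (-(η * (w - b))), (Real.exp_pos _).le, fun h => absurd h hw, fun x => ?_⟩
    have h3 : Real.exp (-(η * (w + x - b)))
        = Real.exp (-(η * (w - b))) * Real.exp (-(η * x)) := by
      rw [← Real.exp_add]; ring_nf
    have h4 : saturate b η w + Real.exp (-(η * (w - b))) * ((1 - Real.exp (-(η * x))) / η)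
        = b + (1 - Real.exp (-(η * (w + x - b)))) / η := by
      unfold saturate
      rw [if_neg hw, h3]
      field_simp
      ring
    rw [h4]
    unfold saturate
    split_ifs with hx
    · have := key (w + x - b)
      linarith
    · exact le_rfl

/-- To first order the drift is (u - v) - ρ(u + v)/2 ≥ (u - v)/2. The rate ρ/5 is small enough for
the quadratic loss to cost at most (u - v)/4, leaving (u - v)/4. Above b only nonnegativity is kept.
-/
lemma saturate_drift {b ρ : ℝ} (hρ0 : 0 < ρ) (hρ1 : ρ ≤ 1) {u v : ℝ} (hu : 0 ≤ u) (hv : 0 ≤ v)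
    (huv : ρ * (u + v) ≤ u - v) (w : ℝ) :
    (if w ≤ b then (u - v) / 4 else 0) ≤
      u * (saturate b (ρ / 5) (w + (1 - ρ / 2)) - saturate b (ρ / 5) w)
        + v * (saturate b (ρ / 5) (w + (-1 - ρ / 2)) - saturate b (ρ / 5) w) := by
  have hη : 0 < ρ / 5 := by positivity
  obtain ⟨c, hc0, hc1, hc⟩ := saturate_tangent (b := b) hη w
  have e1 := hc (1 - ρ / 2)
  have e2 := hc (-1 - ρ / 2)
  have lin : ∀ y : ℝ, |y| ≤ 1 → y - y ^ 2 ≤ 1 - Real.exp (-y) := fun y hy => by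
    have := Real.abs_exp_sub_one_sub_id_le (x := -y) (by rwa [abs_neg])
    have := (abs_le.1 this).2
    nlinarith
  have g1 := lin (ρ / 5 * (1 - ρ / 2)) (abs_le.2 ⟨by nlinarith, by nlinarith⟩)
  have g2 := lin (ρ / 5 * (-1 - ρ / 2)) (abs_le.2 ⟨by nlinarith, by nlinarith⟩)
  have d0 : 0 ≤ u - v := le_trans (by positivity) huv
  have main : (u - v) / 4 ≤ u * ((1 - Real.exp (-(ρ / 5 * (1 - ρ / 2)))) / (ρ / 5))
      + v * ((1 - Real.exp (-(ρ / 5 * (-1 - ρ / 2)))) / (ρ / 5)) := by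
    rw [← mul_div_assoc, ← mul_div_assoc, ← add_div, le_div_iff₀ hη]
    have a1 := mul_le_mul_of_nonneg_left g1 hu
    have a2 := mul_le_mul_of_nonneg_left g2 hv
    refine le_trans ?_ (add_le_add a1 a2)
    have e : u * (ρ / 5 * (1 - ρ / 2) - (ρ / 5 * (1 - ρ / 2)) ^ 2)
        + v * (ρ / 5 * (-1 - ρ / 2) - (ρ / 5 * (-1 - ρ / 2)) ^ 2)
        = ρ / 5 * ((u - v) - ρ * (u + v) / 2 - ρ * (u + v) / 5 * (1 + ρ ^ 2 / 4)
            + ρ ^ 2 / 5 * (u - v)) := by ring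
    rw [e, mul_comm ((u - v) / 4)]
    apply mul_le_mul_of_nonneg_left _ hη.le
    have h1 : 0 ≤ ρ ^ 2 / 5 * (u - v) := by positivity
    have h2 : ρ * (u + v) / 5 * (1 + ρ ^ 2 / 4) ≤ (u - v) / 5 * (1 + 1 / 4) := by
      gcongr
      nlinarith
    linarith
  have hsum : c * (u * ((1 - Real.exp (-(ρ / 5 * (1 - ρ / 2)))) / (ρ / 5))
      + v * ((1 - Real.exp (-(ρ / 5 * (-1 - ρ / 2)))) / (ρ / 5))) ≤
      u * (saturate b (ρ / 5) (w + (1 - ρ / 2)) - saturate b (ρ / 5) w)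
        + v * (saturate b (ρ / 5) (w + (-1 - ρ / 2)) - saturate b (ρ / 5) w) := by
    have a1 := mul_le_mul_of_nonneg_left e1 hu
    have a2 := mul_le_mul_of_nonneg_left e2 hv
    linarith
  refine le_trans ?_ hsum
  split_ifs with hw
  · rw [hc1 hw, one_mul]; exact main
  · exact mul_nonneg hc0 (le_trans (by linarith) main)

/-- For u = v this is cosh μ ≤ exp(μ²/2); a surplus of u puts weight on the smaller exponential. -/
lemma exp_drift {u v : ℝ} (huv : v ≤ u) (hv : 0 ≤ v) {μ : ℝ} (hμ : 0 ≤ μ) :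
    u * (Real.exp (-μ - μ ^ 2 / 2) - 1) + v * (Real.exp (μ - μ ^ 2 / 2) - 1) ≤ 0 := by
  have h1 : Real.exp (-μ) ≤ Real.exp μ := Real.exp_le_exp.2 (by linarith)
  have h2 := Real.cosh_le_exp_half_sq μ
  rw [Real.cosh_eq] at h2
  have h3 : Real.exp (-μ - μ ^ 2 / 2) = Real.exp (-μ) * Real.exp (-(μ ^ 2 / 2)) := by
    rw [← Real.exp_add]; ring_nf
  have h4 : Real.exp (μ - μ ^ 2 / 2) = Real.exp μ * Real.exp (-(μ ^ 2 / 2)) := by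
    rw [← Real.exp_add]; ring_nf
  have h5 : (Real.exp μ + Real.exp (-μ)) * Real.exp (-(μ ^ 2 / 2)) ≤ 2 := by
    rw [Real.exp_neg (μ ^ 2 / 2), ← div_eq_mul_inv, div_le_iff₀ (Real.exp_pos _)]
    linarith
  have h6 := Real.exp_pos (-(μ ^ 2 / 2))
  rw [h3, h4]
  have h7 : (u - v) * ((Real.exp μ - Real.exp (-μ)) * Real.exp (-(μ ^ 2 / 2))) ≥ 0 :=
    mul_nonneg (by linarith) (mul_nonneg (by linarith) h6.le)
  have h8 : (u + v) * ((Real.exp μ + Real.exp (-μ)) * Real.exp (-(μ ^ 2 / 2))) ≤ (u + v) * 2 :=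
    mul_le_mul_of_nonneg_left h5 (by linarith)
  nlinarith

/-! ### Neighbouring pairs and inversions under exchanges -/

/-- The two neighbours at positions `p` and `p + 1`, the smaller item first. -/
def adjPair (R : RankedList K) (p : Fin (K - 1)) : Fin K × Fin K :=
  (min (R (lo p)) (R (hi p)), max (R (lo p)) (R (hi p)))

/-- All pairs of neighbours in a list. -/
def adjPairs (R : RankedList K) : Finset (Fin K × Fin K) := Finset.univ.image (adjPair R)

lemma lo_ne_hi (p : Fin (K - 1)) : lo p ≠ hi p := by
  simp [lo, hi, Fin.ext_iff]

lemma lo_lt_hi (p : Fin (K - 1)) : lo p < hi p := by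
  rw [Fin.lt_def]; simp [lo, hi]

lemma mul_swap_symm_apply (R : RankedList K) (a b i : Fin K) :
    (R * Equiv.swap a b).symm i = Equiv.swap a b (R.symm i) := rfl

lemma adjPair_lt (R : RankedList K) (p : Fin (K - 1)) : (adjPair R p).1 < (adjPair R p).2 := by
  have : R (lo p) ≠ R (hi p) := fun h => lo_ne_hi p (R.injective h)
  simpa [adjPair, eq_comm] using this

lemma adjPair_injective (R : RankedList K) : Function.Injective (adjPair R) := by
  intro p q h
  simp only [adjPair, Prod.mk.injEq] at h
  obtain ⟨h1, h2⟩ := h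
  have h3 : (R (lo p) = R (lo q) ∧ R (hi p) = R (hi q)) ∨
      (R (lo p) = R (hi q) ∧ R (hi p) = R (lo q)) := by
    rcases le_total (R (lo p)) (R (hi p)) with a | a <;>
    rcases le_total (R (lo q)) (R (hi q)) with b | b <;>
    simp [a, b] at h1 h2 <;> simp [h1, h2]
  simp only [R.injective.eq_iff, lo, hi, Fin.ext_iff] at h3
  ext
  omega

lemma card_adjPairs_le (R : RankedList K) : (adjPairs R).card ≤ K - 1 := by
  simpa [adjPairs] using Finset.card_image_le (s := Finset.univ) (f := adjPair R)

/-- `R'` arises from `R` by exchanges of inverted neighbours: it has at most two new pairs of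
neighbours per inversion removed. -/
def Improves (R R' : RankedList K) : Prop :=
  (∃ N : Finset (Fin K × Fin K), adjPairs R' ⊆ adjPairs R ∪ N ∧
    N.card + 2 * (incorrectPairs R').card ≤ 2 * (incorrectPairs R).card) ∧
  (R' = R ∨ (incorrectPairs R').card < (incorrectPairs R).card)

lemma Improves.refl (R : RankedList K) : Improves R R :=
  ⟨⟨∅, by simp, by simp⟩, Or.inl rfl⟩

lemma Improves.trans {R R' R'' : RankedList K} (h : Improves R R') (h' : Improves R' R'') :
    Improves R R'' := by
  obtain ⟨⟨N, h1, h2⟩, h3⟩ := h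
  obtain ⟨⟨N', h1', h2'⟩, h3'⟩ := h'
  refine ⟨⟨N ∪ N', ?_, ?_⟩, ?_⟩
  · intro x hx
    have := h1' hx
    simp only [Finset.mem_union] at this ⊢
    rcases this with h | h
    · have := h1 h
      simp only [Finset.mem_union] at this
      tauto
    · tauto
  · have := Finset.card_union_le N N'
    omega
  · rcases h3 with rfl | h3
    · exact h3'
    · rcases h3' with rfl | h3'
      · exact Or.inr h3
      · exact Or.inr (h3'.trans h3)

/-- Exchanging neighbours alters the relative order of these two items only. -/
lemma incorrectPairs_swap (R : RankedList K) (q : Fin (K - 1)) (h : R (hi q) < R (lo q)) :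
    (incorrectPairs (R * Equiv.swap (lo q) (hi q))).card < (incorrectPairs R).card := by
  apply Finset.card_lt_card
  rw [Finset.ssubset_iff_of_subset]
  · refine ⟨(R (hi q), R (lo q)), ?_, ?_⟩
    · simp [incorrectPairs, h, lo_lt_hi]
    · intro hm
      have := (Finset.mem_filter.1 hm).2.2
      simp only [mul_swap_symm_apply, Equiv.symm_apply_apply, Equiv.swap_apply_left,
        Equiv.swap_apply_right] at this
      exact this.asymm (lo_lt_hi q)
  · intro x hx
    simp only [incorrectPairs, Finset.mem_filter, Finset.mem_univ, true_and] at hx ⊢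
    refine ⟨hx.1, ?_⟩
    obtain ⟨i, j⟩ := x
    obtain ⟨hij, hs⟩ := hx
    obtain ⟨a, rfl⟩ := R.surjective i
    obtain ⟨b, rfl⟩ := R.surjective j
    simp only [mul_swap_symm_apply, Equiv.symm_apply_apply] at hs hij ⊢
    have hne : a ≠ b := fun e => by simp [e] at hij
    by_cases h1 : a = lo q ∧ b = hi q
    · obtain ⟨rfl, rfl⟩ := h1
      exact absurd h hij.asymm
    · rw [Equiv.swap_apply_def, Equiv.swap_apply_def] at hs
      simp only [lo, hi, Fin.ext_iff] at h1 hs hne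
      rw [Fin.lt_def] at hs ⊢
      split_ifs at hs <;> simp at hs <;> omega

/-- The pair at q stays the same as an unordered pair, so new neighbours can arise only at q - 1 and
q + 1. -/
lemma Improves.swap (R : RankedList K) (q : Fin (K - 1)) (h : R (hi q) < R (lo q)) :
    Improves R (R * Equiv.swap (lo q) (hi q)) := by
  have hlt := incorrectPairs_swap R q h
  refine ⟨⟨(Finset.univ.filter fun p : Fin (K - 1) =>
      (p : ℕ) + 1 = q ∨ (p : ℕ) = q + 1).image (adjPair (R * Equiv.swap (lo q) (hi q))), ?_, ?_⟩,
    Or.inr hlt⟩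
  · intro x hx
    obtain ⟨p, -, rfl⟩ := Finset.mem_image.1 hx
    by_cases hp : (p : ℕ) + 1 = q ∨ (p : ℕ) = q + 1
    · exact Finset.mem_union_right _ (Finset.mem_image_of_mem _ (by simpa using hp))
    · apply Finset.mem_union_left
      refine Finset.mem_image.2 ⟨p, Finset.mem_univ _, ?_⟩
      by_cases hpq : p = q
      · subst hpq
        simp [adjPair, min_comm, max_comm]
      · have hpq' : (p : ℕ) ≠ q := fun e => hpq (Fin.ext e)
        have e1 : Equiv.swap (lo q) (hi q) (lo p) = lo p :=
          Equiv.swap_apply_of_ne_of_ne (by simp [lo, Fin.ext_iff]; omega)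
            (by simp [lo, hi, Fin.ext_iff]; omega)
        have e2 : Equiv.swap (lo q) (hi q) (hi p) = hi p :=
          Equiv.swap_apply_of_ne_of_ne (by simp [lo, hi, Fin.ext_iff]; omega)
            (by simp [hi, Fin.ext_iff]; omega)
        simp [adjPair, e1, e2]
  · have h2 : (Finset.univ.filter fun p : Fin (K - 1) =>
        (p : ℕ) + 1 = q ∨ (p : ℕ) = q + 1).card ≤ 2 := by
      have : ((Finset.univ.filter fun p : Fin (K - 1) =>
        (p : ℕ) + 1 = q ∨ (p : ℕ) = q + 1).image Fin.val) ⊆ {(q : ℕ) - 1, (q : ℕ) + 1} := by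
        intro y hy
        simp only [Finset.mem_image, Finset.mem_filter, Finset.mem_univ, true_and] at hy
        obtain ⟨p, hp, rfl⟩ := hy
        simp only [Finset.mem_insert, Finset.mem_singleton]
        omega
      rw [← Finset.card_image_of_injective _ Fin.val_injective]
      exact (Finset.card_le_card this).trans Finset.card_le_two
    have := Finset.card_image_le (s := Finset.univ.filter fun p : Fin (K - 1) =>
      (p : ℕ) + 1 = q ∨ (p : ℕ) = q + 1) (f := adjPair (R * Equiv.swap (lo q) (hi q)))
    omega

/-- No inverted pair is believed with confidence to be in the right order. -/
def Good (δ : ℝ) (S : State K) : Prop := ∀ i j, i < j → ¬ Confident δ S.s S.n j i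

open Classical in
lemma bubble_improves {δ : ℝ} {s : Fin K → Fin K → ℤ} {n : Fin K → Fin K → ℕ}
    (hg : ∀ i j, i < j → ¬ Confident δ s n j i) (R : RankedList K) :
    Improves R (bubble δ s n R) := by
  unfold bubble
  generalize List.finRange (K - 1) = l
  induction l generalizing R with
  | nil => exact Improves.refl R
  | cons p l ih =>
    rw [List.foldl_cons]
    refine Improves.trans ?_ (ih _)
    split_ifs with h
    · refine Improves.swap R p ?_
      rcases lt_trichotomy (R (hi p)) (R (lo p)) with h' | h' | h'
      · exact h'
      · exact absurd (R.injective h').symm (lo_ne_hi p)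
      · exact absurd h (hg _ _ h')
    · exact Improves.refl R

-- A pass that returns its input cannot have exchanged and exchanged back: each exchange strictly
-- lowers the number of inversions. Hence no test fired, and every test was made on the original
-- list.
open Classical in
lemma not_confident_of_bubble_eq {δ : ℝ} {s : Fin K → Fin K → ℤ} {n : Fin K → Fin K → ℕ}
    (hg : ∀ i j, i < j → ¬ Confident δ s n j i) {R : RankedList K}
    (h : bubble δ s n R = R) (p : Fin (K - 1)) : ¬ Confident δ s n (R (hi p)) (R (lo p)) := by
  have key : ∀ l : List (Fin (K - 1)), ∀ R : RankedList K,
      (incorrectPairs (l.foldl (fun R p =>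
        if Confident δ s n (R (hi p)) (R (lo p)) then R * Equiv.swap (lo p) (hi p) else R)
        R)).card ≤ (incorrectPairs R).card ∧
      ((incorrectPairs (l.foldl (fun R p =>
        if Confident δ s n (R (hi p)) (R (lo p)) then R * Equiv.swap (lo p) (hi p) else R)
        R)).card = (incorrectPairs R).card →
        ∀ p ∈ l, ¬ Confident δ s n (R (hi p)) (R (lo p))) := by
    intro l
    induction l with
    | nil => simp
    | cons q l ih =>
      intro R
      rw [List.foldl_cons]
      split_ifs with hq
      · have hlt := incorrectPairs_swap R q (by
          rcases lt_trichotomy (R (hi q)) (R (lo q)) with h' | h' | h'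
          · exact h'
          · exact absurd (R.injective h').symm (lo_ne_hi q)
          · exact absurd hq (hg _ _ h'))
        have := (ih (R * Equiv.swap (lo q) (hi q))).1
        exact ⟨by omega, fun h => by omega⟩
      · refine ⟨(ih R).1, fun h => ?_⟩
        have := (ih R).2 h
        intro p hp
        rcases List.mem_cons.1 hp with rfl | hp
        · exact hq
        · exact this p hp
  refine (key (List.finRange (K - 1)) R).2 ?_ p (List.mem_finRange p)
  have h' := h
  unfold bubble at h'
  rw [h']

end BubbleRank

namespace BubbleRank

variable {K : ℕ}

/-! ### The displayed list -/

/-- The `p`-th pair of neighbours in the base list is exchanged in the displayed list. -/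
def Flipped (δ : ℝ) (t : ℕ) (S : State K) (coin : Fin (K - 1) → Bool) (p : Fin (K - 1)) : Prop :=
  Slot t p ∧ ¬ Confident δ S.s S.n (S.base (lo p)) (S.base (hi p)) ∧ coin p = true

lemma slot_disjoint {t : ℕ} {p q : Fin (K - 1)} (hp : Slot t p) (hq : Slot t q) (h : p ≠ q) :
    lo p ≠ lo q ∧ lo p ≠ hi q ∧ hi p ≠ lo q ∧ hi p ≠ hi q := by
  have h' : (p : ℕ) ≠ q := fun e => h (Fin.ext e)
  unfold Slot at hp hq
  simp only [lo, hi, ne_eq, Fin.ext_iff]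
  omega

-- The fold tests confidence in a partially exchanged list, but the handled pairs are disjoint, so
-- each test still sees the items of the base list.
open Classical in
lemma display_spec (δ : ℝ) (t : ℕ) (S : State K) (coin : Fin (K - 1) → Bool) :
    (∀ p, Flipped δ t S coin p → display δ t S coin (lo p) = S.base (hi p)
      ∧ display δ t S coin (hi p) = S.base (lo p)) ∧
    ∀ k, (∀ p, Flipped δ t S coin p → k ≠ lo p ∧ k ≠ hi p) →
      display δ t S coin k = S.base k := by
  have key : ∀ l : List (Fin (K - 1)), l.Nodup → ∀ R : RankedList K, R = l.foldl
      (fun R p => if Slot t p ∧ ¬ Confident δ S.s S.n (R (lo p)) (R (hi p)) ∧ coin p = true then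
        R * Equiv.swap (lo p) (hi p) else R) S.base →
      (∀ p ∈ l, Flipped δ t S coin p → R (lo p) = S.base (hi p) ∧ R (hi p) = S.base (lo p)) ∧
      ∀ k, (∀ p ∈ l, Flipped δ t S coin p → k ≠ lo p ∧ k ≠ hi p) → R k = S.base k := by
    intro l
    induction l using List.reverseRecOn with
    | nil => intro _ R hR; simp [hR]
    | append_singleton l q ih =>
      intro hnd R hR
      rw [List.foldl_append, List.foldl_cons, List.foldl_nil] at hR
      have hnd' := List.nodup_append.1 hnd
      have hq : q ∉ l := fun hm => hnd'.2.2 q hm q (by simp) rfl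
      obtain ⟨ih1, ih2⟩ := ih hnd'.1 _ rfl
      set R₁ := l.foldl (fun R p => if Slot t p ∧ ¬ Confident δ S.s S.n (R (lo p)) (R (hi p))
        ∧ coin p = true then R * Equiv.swap (lo p) (hi p) else R) S.base with hR₁
      have hfix : Slot t q → R₁ (lo q) = S.base (lo q) ∧ R₁ (hi q) = S.base (hi q) := by
        intro hs
        constructor <;>
        · refine ih2 _ fun p hp hf => ?_
          have := slot_disjoint hs hf.1 (fun e => hq (e ▸ hp))
          tauto
      have hcond : (Slot t q ∧ ¬ Confident δ S.s S.n (R₁ (lo q)) (R₁ (hi q)) ∧ coin q = true)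
          ↔ Flipped δ t S coin q := by
        unfold Flipped
        constructor
        · rintro ⟨h1, h2⟩
          rw [(hfix h1).1, (hfix h1).2] at h2
          exact ⟨h1, h2⟩
        · rintro ⟨h1, h2⟩
          rw [(hfix h1).1, (hfix h1).2]
          exact ⟨h1, h2⟩
      by_cases hf : Flipped δ t S coin q
      · rw [if_pos (hcond.2 hf)] at hR
        have hoff : ∀ k, k ≠ lo q → k ≠ hi q → R k = R₁ k := fun k h1 h2 => by
          rw [hR, Equiv.Perm.mul_apply, Equiv.swap_apply_of_ne_of_ne h1 h2]
        refine ⟨fun p hp hfp => ?_, fun k hk => ?_⟩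
        · by_cases hpq : p = q
          · subst hpq
            rw [hR]
            simp [hfix hf.1]
          · have hd := slot_disjoint hfp.1 hf.1 hpq
            rw [hoff _ hd.1 hd.2.1, hoff _ hd.2.2.1 hd.2.2.2]
            exact ih1 p (by simpa [hpq] using hp) hfp
        · have hkq := hk q (by simp) hf
          rw [hoff _ hkq.1 hkq.2]
          exact ih2 k fun p hp => hk p (by simp [hp])
      · rw [if_neg (fun h => hf (hcond.1 h))] at hR
        rw [hR]
        refine ⟨fun p hp hfp => ?_, fun k hk => ih2 k fun p hp => hk p (by simp [hp])⟩
        rcases List.mem_append.1 hp with hp | hp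
        · exact ih1 p hp hfp
        · exact absurd (List.mem_singleton.1 hp ▸ hfp) hf
  have := key (List.finRange (K - 1)) (List.nodup_finRange _) _ rfl
  exact ⟨fun p => this.1 p (List.mem_finRange p),
    fun k hk => this.2 k fun p _ => hk p⟩

lemma display_slot (δ : ℝ) (t : ℕ) (S : State K) (coin : Fin (K - 1) → Bool) {p : Fin (K - 1)}
    (hp : Slot t p) :
    (display δ t S coin (lo p) = S.base (lo p) ∧ display δ t S coin (hi p) = S.base (hi p)) ∨
    (Flipped δ t S coin p ∧ display δ t S coin (lo p) = S.base (hi p)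
      ∧ display δ t S coin (hi p) = S.base (lo p)) := by
  obtain ⟨h1, h2⟩ := display_spec δ t S coin
  by_cases hf : Flipped δ t S coin p
  · exact Or.inr ⟨hf, h1 p hf⟩
  · left
    have : ∀ q, Flipped δ t S coin q → q ≠ p := fun q hq e => hf (e ▸ hq)
    constructor <;>
    · refine h2 _ fun q hq => ?_
      have := slot_disjoint hp hq.1 (this q hq).symm
      tauto

/-- The coins with the `p`-th coin turned over. -/
def turn (p : Fin (K - 1)) (coin : Fin (K - 1) → Bool) : Fin (K - 1) → Bool :=
  Function.update coin p (!coin p)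

lemma turn_involutive (p : Fin (K - 1)) : Function.Involutive (turn p) := by
  intro coin
  simp [turn]

/-- This is the symmetry behind the randomisation: the two values of an active coin give lists that
differ by one exchange. -/
lemma display_turn (δ : ℝ) (t : ℕ) (S : State K) (coin : Fin (K - 1) → Bool) {p : Fin (K - 1)}
    (hp : Slot t p) (hc : ¬ Confident δ S.s S.n (S.base (lo p)) (S.base (hi p))) :
    display δ t S (turn p coin) = display δ t S coin * Equiv.swap (lo p) (hi p) := by
  have hfp : ∀ c : Fin (K - 1) → Bool, Flipped δ t S c p ↔ c p = true := fun c => by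
    simp [Flipped, hp, hc]
  have hfq : ∀ q, q ≠ p → (Flipped δ t S (turn p coin) q ↔ Flipped δ t S coin q) := fun q hq => by
    simp [Flipped, turn, hq]
  obtain ⟨h1, h2⟩ := display_spec δ t S coin
  obtain ⟨h1', h2'⟩ := display_spec δ t S (turn p coin)
  have hturn : turn p coin p = !coin p := by simp [turn]
  have hrest : ∀ k, k ≠ lo p → k ≠ hi p → display δ t S (turn p coin) k = display δ t S coin k := by
    intro k hk1 hk2
    by_cases h : ∃ q, Flipped δ t S coin q ∧ (k = lo q ∨ k = hi q)
    · obtain ⟨q, hq, hk⟩ := h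
      have hqp : q ≠ p := by rintro rfl; tauto
      have hq' := (hfq q hqp).2 hq
      rcases hk with rfl | rfl
      · rw [(h1 q hq).1, (h1' q hq').1]
      · rw [(h1 q hq).2, (h1' q hq').2]
    · push Not at h
      rw [h2 k h, h2']
      intro q hq
      by_cases hqp : q = p
      · subst hqp; exact ⟨hk1, hk2⟩
      · exact h q ((hfq q hqp).1 hq)
  have hends : ∀ c : Fin (K - 1) → Bool, c p = false →
      display δ t S c (lo p) = S.base (lo p) ∧ display δ t S c (hi p) = S.base (hi p) := by
    intro c hcp
    rcases display_slot δ t S c hp with h | h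
    · exact h
    · have := (hfp c).1 h.1
      simp [hcp] at this
  ext1 k
  rw [Equiv.Perm.mul_apply]
  by_cases hk1 : k = lo p
  · subst hk1
    rw [Equiv.swap_apply_left]
    cases hcp : coin p
    · rw [(hends coin hcp).2, (h1' p ((hfp _).2 (by rw [hturn, hcp]; rfl))).1]
    · rw [(h1 p ((hfp _).2 hcp)).2, (hends _ (by rw [hturn, hcp]; rfl)).1]
  by_cases hk2 : k = hi p
  · subst hk2
    rw [Equiv.swap_apply_right]
    cases hcp : coin p
    · rw [(hends coin hcp).1, (h1' p ((hfp _).2 (by rw [hturn, hcp]; rfl))).2]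
    · rw [(h1 p ((hfp _).2 hcp)).1, (hends _ (by rw [hturn, hcp]; rfl)).2]
  rw [Equiv.swap_apply_of_ne_of_ne hk1 hk2, hrest k hk1 hk2]

lemma paired_comm {t : ℕ} {a b : Fin K} : Paired t a b ↔ Paired t b a := by
  unfold Paired
  constructor <;> rintro ⟨p, hp, h⟩ <;> exact ⟨p, hp, by tauto⟩

lemma paired_symm_iff {t : ℕ} (R : RankedList K) (i j : Fin K) :
    Paired t (R.symm i) (R.symm j) ↔
      ∃ p, Slot t p ∧ ((i = R (lo p) ∧ j = R (hi p)) ∨ (i = R (hi p) ∧ j = R (lo p))) := by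
  simp only [Paired, Equiv.symm_apply_eq]

/-- Coins permute items only inside handled pairs, so the items compared in a step are fixed before
the coins are tossed. -/
lemma paired_display (δ : ℝ) (t : ℕ) (S : State K) (coin : Fin (K - 1) → Bool) (i j : Fin K) :
    Paired t ((display δ t S coin).symm i) ((display δ t S coin).symm j) ↔
      Paired t (S.base.symm i) (S.base.symm j) := by
  rw [paired_symm_iff, paired_symm_iff]
  refine exists_congr fun p => and_congr_right fun hp => ?_
  rcases display_slot δ t S coin hp with h | ⟨-, h⟩ <;> rw [h.1, h.2]
  tauto

/-! ### Evolution of the statistics and histories -/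

/-- The click on item `i` minus the click on item `j` in one step. -/
noncomputable def clickDiff (δ : ℝ) (t : ℕ) (S : State K) (i j : Fin K) (w : Outcome K) : ℤ :=
  click w.1.1 w.1.2 (display δ t S w.2) ((display δ t S w.2).symm i)
    - click w.1.1 w.1.2 (display δ t S w.2) ((display δ t S w.2).symm j)

lemma click_cases (A : AttractionVec K) (X : ExaminationMat K) (R : RankedList K) (k : Fin K) :
    click A X R k = 0 ∨ click A X R k = 1 := by
  unfold click; split_ifs <;> simp

lemma clickDiff_cases (δ : ℝ) (t : ℕ) (S : State K) (i j : Fin K) (w : Outcome K) :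
    clickDiff δ t S i j w = 0 ∨ clickDiff δ t S i j w = 1 ∨ clickDiff δ t S i j w = -1 := by
  unfold clickDiff
  rcases click_cases w.1.1 w.1.2 (display δ t S w.2) ((display δ t S w.2).symm i) with h | h <;>
  rcases click_cases w.1.1 w.1.2 (display δ t S w.2) ((display δ t S w.2).symm j) with h' | h' <;>
  rw [h, h'] <;> simp

lemma step_of_not_paired {δ : ℝ} {t : ℕ} {S : State K} {i j : Fin K}
    (h : ¬ Paired t (S.base.symm i) (S.base.symm j)) (w : Outcome K) :
    (step δ t S w).s i j = S.s i j ∧ (step δ t S w).n i j = S.n i j := by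
  simp [step, updateS, updateN, paired_display, h]

lemma step_of_paired {δ : ℝ} {t : ℕ} {S : State K} {i j : Fin K}
    (h : Paired t (S.base.symm i) (S.base.symm j)) (w : Outcome K) :
    (step δ t S w).s i j = S.s i j + clickDiff δ t S i j w ∧
      ((step δ t S w).n i j : ℤ) = S.n i j + |clickDiff δ t S i j w| := by
  have hc := clickDiff_cases δ t S i j w
  unfold clickDiff at hc ⊢
  refine ⟨by simp [step, updateS, paired_display, h], ?_⟩
  simp only [step, updateN, paired_display, h, true_and]
  split_ifs with hd
  · rw [hd]; push_cast; ring
  · rcases hc with hc | hc | hc <;> rw [hc] at hd ⊢ <;> simp at hd ⊢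

/-- Consistency of the statistics after `t` steps. -/
structure Consistent (t : ℕ) (S : State K) : Prop where
  s_symm : ∀ i j, S.s j i = - S.s i j
  n_symm : ∀ i j, S.n j i = S.n i j
  abs_s_le : ∀ i j, |S.s i j| ≤ S.n i j
  n_le : ∀ i j, S.n i j ≤ t

lemma clickDiff_swap (δ : ℝ) (t : ℕ) (S : State K) (i j : Fin K) (w : Outcome K) :
    clickDiff δ t S j i w = - clickDiff δ t S i j w := by
  unfold clickDiff; ring

lemma Consistent.step {δ : ℝ} {t u : ℕ} {S : State K} (h : Consistent t S) (w : Outcome K) :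
    Consistent (t + 1) (step δ u S w) := by
  constructor
  · intro i j
    by_cases hp : Paired u (S.base.symm i) (S.base.symm j)
    · rw [(step_of_paired hp w).1, (step_of_paired (paired_comm.1 hp) w).1, clickDiff_swap,
        h.s_symm]; ring
    · rw [(step_of_not_paired hp w).1,
        (step_of_not_paired (fun h => hp (paired_comm.1 h)) w).1, h.s_symm]
  · intro i j
    by_cases hp : Paired u (S.base.symm i) (S.base.symm j)
    · have h1 := (step_of_paired (δ := δ) hp w).2
      have h2 := (step_of_paired (δ := δ) (paired_comm.1 hp) w).2
      rw [clickDiff_swap, abs_neg, h.n_symm, ← h1] at h2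
      exact_mod_cast h2
    · rw [(step_of_not_paired hp w).2,
        (step_of_not_paired (fun h => hp (paired_comm.1 h)) w).2, h.n_symm]
  · intro i j
    by_cases hp : Paired u (S.base.symm i) (S.base.symm j)
    · rw [(step_of_paired hp w).1, (step_of_paired hp w).2]
      exact (abs_add_le _ _).trans (add_le_add_left (h.abs_s_le i j) _)
    · rw [(step_of_not_paired hp w).1, (step_of_not_paired hp w).2]
      exact h.abs_s_le i j
  · intro i j
    have := h.n_le i j
    by_cases hp : Paired u (S.base.symm i) (S.base.symm j)
    · have h1 := (step_of_paired (δ := δ) hp w).2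
      rcases clickDiff_cases δ u S i j w with hc | hc | hc <;> rw [hc] at h1 <;> simp at h1 <;>
        omega
    · rw [(step_of_not_paired hp w).2]
      omega

lemma consistent_stateAfter (δ : ℝ) (R₀ : RankedList K) (ω : ℕ → Outcome K) (t : ℕ) :
    Consistent t (stateAfter δ R₀ ω t) := by
  induction t with
  | zero => constructor <;> simp [stateAfter, init]
  | succ t ih => exact ih.step _

/-- No inverted pair was ever believed to be in the right order, up to time `t`. -/
def Alive (δ : ℝ) (R₀ : RankedList K) (ω : ℕ → Outcome K) (t : ℕ) : Prop :=
  ∀ u ≤ t, Good δ (stateAfter δ R₀ ω u)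

/-- The pairs that were neighbours in some base list up to time `t`. -/
noncomputable def seenPairs (δ : ℝ) (R₀ : RankedList K) (ω : ℕ → Outcome K) (t : ℕ) : Finset (Fin K × Fin K) :=
  (Finset.range (t + 1)).biUnion fun u => adjPairs (stateAfter δ R₀ ω u).base

lemma adjPairs_subset_seenPairs (δ : ℝ) (R₀ : RankedList K) (ω : ℕ → Outcome K) (t : ℕ) :
    adjPairs (stateAfter δ R₀ ω t).base ⊆ seenPairs δ R₀ ω t :=
  Finset.subset_biUnion_of_mem (fun u => adjPairs (stateAfter δ R₀ ω u).base) (by simp)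

lemma seenPairs_succ (δ : ℝ) (R₀ : RankedList K) (ω : ℕ → Outcome K) (t : ℕ) :
    seenPairs δ R₀ ω (t + 1)
      = seenPairs δ R₀ ω t ∪ adjPairs (stateAfter δ R₀ ω (t + 1)).base := by
  unfold seenPairs
  rw [Finset.range_add_one, Finset.biUnion_insert, Finset.union_comm]

lemma seenPairs_lt {δ : ℝ} {R₀ : RankedList K} {ω : ℕ → Outcome K} {t : ℕ} {e : Fin K × Fin K}
    (he : e ∈ seenPairs δ R₀ ω t) : e.1 < e.2 := by
  simp only [seenPairs, adjPairs, Finset.mem_biUnion, Finset.mem_image] at he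
  obtain ⟨u, -, p, -, rfl⟩ := he
  exact adjPair_lt _ p

lemma mem_adjPairs_of_paired {t : ℕ} {R : RankedList K} {i j : Fin K} (hij : i < j)
    (h : Paired t (R.symm i) (R.symm j)) : (i, j) ∈ adjPairs R := by
  obtain ⟨p, -, h⟩ := (paired_symm_iff R i j).1 h
  refine Finset.mem_image.2 ⟨p, Finset.mem_univ _, ?_⟩
  unfold adjPair
  rcases h with ⟨rfl, rfl⟩ | ⟨rfl, rfl⟩ <;> simp [hij.le]

/-- Only handled pairs are updated, and these are neighbours in the base list. So a pair enters the
potential with no evidence. -/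
lemma eq_zero_of_not_mem_seenPairs {δ : ℝ} {R₀ : RankedList K} {ω : ℕ → Outcome K} {i j : Fin K}
    (hij : i < j) : ∀ {t : ℕ}, (i, j) ∉ seenPairs δ R₀ ω t →
      (stateAfter δ R₀ ω t).s i j = 0 ∧ (stateAfter δ R₀ ω t).n i j = 0 := by
  intro t
  induction t with
  | zero => intro _; simp [stateAfter, init]
  | succ t ih =>
    intro h
    rw [seenPairs_succ, Finset.mem_union, not_or] at h
    have hp : ¬ Paired (t + 1) ((stateAfter δ R₀ ω t).base.symm i)
        ((stateAfter δ R₀ ω t).base.symm j) := fun hp =>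
      h.1 (adjPairs_subset_seenPairs _ _ _ _ (mem_adjPairs_of_paired hij hp))
    have := step_of_not_paired (δ := δ) hp (ω t)
    rw [stateAfter, this.1, this.2]
    exact ih h.1

lemma base_improves {δ : ℝ} {S : State K} {t : ℕ} {w : Outcome K} (h : Good δ (step δ t S w)) :
    Improves S.base (step δ t S w).base :=
  bubble_improves h S.base

lemma stateAfter_congr {δ : ℝ} {R₀ : RankedList K} {ω ω' : ℕ → Outcome K} {t : ℕ}
    (h : ∀ u < t, ω u = ω' u) : ∀ u ≤ t, stateAfter δ R₀ ω u = stateAfter δ R₀ ω' u := by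
  intro u
  induction u with
  | zero => intro _; rfl
  | succ u ih =>
    intro hu
    rw [stateAfter, stateAfter, ih (by omega), h u (by omega)]

end BubbleRank

namespace BubbleRank

/-! ### Conditioning on the past by resampling one coordinate -/

section Resampling

variable {X : Type*} [MeasurableSpace X]

lemma measurable_update_prod (t : ℕ) :
    Measurable fun q : (ℕ → X) × X => Function.update q.1 t q.2 := by
  refine measurable_pi_lambda _ fun i => ?_
  by_cases hi : i = t
  · subst hi; simpa using measurable_snd
  · simp only [Function.update_of_ne hi]
    exact (measurable_pi_apply i).comp measurable_fst

lemma map_update_infinitePi (P : Measure X) [IsProbabilityMeasure P] (t : ℕ) :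
    ((Measure.infinitePi fun _ : ℕ => P).prod P).map (fun q => Function.update q.1 t q.2)
      = Measure.infinitePi fun _ : ℕ => P := by
  have hm := measurable_update_prod (X := X) t
  refine Measure.eq_infinitePi _ fun s T hT => ?_
  rw [Measure.map_apply hm (MeasurableSet.pi s.countable_toSet fun i _ => hT i)]
  have hpre : (fun q : (ℕ → X) × X => Function.update q.1 t q.2) ⁻¹' (Set.pi s T)
      = (Set.pi (s.erase t : Finset ℕ) T) ×ˢ (if t ∈ s then T t else Set.univ) := by
    ext q
    simp only [Set.mem_preimage, Set.mem_pi, Finset.mem_coe, Set.mem_prod, Finset.mem_erase]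
    constructor
    · intro h
      refine ⟨fun i hi => by simpa [Function.update_of_ne hi.1] using h i hi.2, ?_⟩
      split_ifs with hts
      · simpa using h t hts
      · trivial
    · rintro ⟨h1, h2⟩ i hi
      by_cases hit : i = t
      · subst hit
        simpa [hi] using h2
      · simpa [Function.update_of_ne hit] using h1 i ⟨hit, hi⟩
  rw [hpre, Measure.prod_prod, Measure.infinitePi_pi _ fun i _ => hT i]
  split_ifs with hts
  · rw [Finset.prod_erase_mul _ _ hts]
  · rw [Finset.erase_eq_of_notMem hts, measure_univ, mul_one]

variable [Finite X] [MeasurableSingletonClass X]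

lemma measurable_of_dependsOn_Iio {φ : (ℕ → X) → ℝ} {t : ℕ} (h : DependsOn φ (Set.Iio t)) :
    Measurable φ := by
  obtain ⟨g, rfl⟩ := dependsOn_iff_exists_comp.1 h
  have : Finite ↑(Set.Iio t) := inferInstance
  exact (measurable_of_countable g).comp
    (measurable_pi_lambda _ fun i => measurable_pi_apply _)

lemma integrable_of_dependsOn_Iio {φ : (ℕ → X) → ℝ} {t : ℕ} (h : DependsOn φ (Set.Iio t))
    (μ : Measure (ℕ → X)) [IsFiniteMeasure μ] : Integrable φ μ := by
  have hm := measurable_of_dependsOn_Iio h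
  obtain ⟨g, rfl⟩ := dependsOn_iff_exists_comp.1 h
  obtain ⟨C, hC⟩ := (Set.finite_range fun x => ‖g x‖).bddAbove
  exact Integrable.of_bound hm.aestronglyMeasurable C
    (Filter.Eventually.of_forall fun ω => hC ⟨_, rfl⟩)

/-- Replacing one coordinate by a fresh copy preserves the product law. When φ depends on the
coordinates up to t, the inner integral is its conditional expectation given those before t. -/
lemma integral_resample (P : Measure X) [IsProbabilityMeasure P] {φ : (ℕ → X) → ℝ} {u : ℕ}
    (h : DependsOn φ (Set.Iio u)) (t : ℕ) :
    ∫ ω, φ ω ∂(Measure.infinitePi fun _ : ℕ => P)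
      = ∫ ω, ∫ w, φ (Function.update ω t w) ∂P ∂(Measure.infinitePi fun _ : ℕ => P) := by
  have hm := measurable_update_prod (X := X) t
  have hφ := measurable_of_dependsOn_Iio h
  conv_lhs => rw [← map_update_infinitePi P t]
  rw [integral_map hm.aemeasurable hφ.aestronglyMeasurable]
  refine integral_prod (fun q : (ℕ → X) × X => φ (Function.update q.1 t q.2)) ?_
  have := integrable_of_dependsOn_Iio h (Measure.infinitePi fun _ : ℕ => P)
  rw [← map_update_infinitePi P t] at this
  exact (integrable_map_measure hφ.aestronglyMeasurable hm.aemeasurable).1 this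

/-- A potential that decreases on average by at least `h` in each step bounds the expected
total of `h`. -/
lemma sum_integral_add_le_of_drift (P : Measure X) [IsProbabilityMeasure P]
    {φ h : ℕ → (ℕ → X) → ℝ} (hφ : ∀ t, DependsOn (φ t) (Set.Iio t))
    (hh : ∀ t, DependsOn (h t) (Set.Iio t)) {n : ℕ}
    (drift : ∀ t < n, ∀ ω, ∫ w, φ (t + 1) (Function.update ω t w) ∂P + h t ω ≤ φ t ω) :
    ∑ t ∈ Finset.range n, ∫ ω, h t ω ∂(Measure.infinitePi fun _ : ℕ => P)
      + ∫ ω, φ n ω ∂(Measure.infinitePi fun _ : ℕ => P)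
      ≤ ∫ ω, φ 0 ω ∂(Measure.infinitePi fun _ : ℕ => P) := by
  induction n with
  | zero => simp
  | succ n ih =>
    refine le_trans ?_ (ih fun t ht => drift t (by omega))
    rw [Finset.sum_range_succ, add_assoc]
    refine add_le_add_right ?_ _
    have hdep : DependsOn (fun ω => ∫ w, φ (n + 1) (Function.update ω n w) ∂P) (Set.Iio n) := by
      intro ω ω' hω
      refine integral_congr_ae (Filter.Eventually.of_forall fun w => hφ (n + 1) fun i hi => ?_)
      by_cases hin : i = n
      · subst hin; simp
      · simp only [Set.mem_Iio] at hi
        simpa [Function.update_of_ne hin] using hω i (by simp only [Set.mem_Iio]; omega)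
    rw [integral_resample P (hφ (n + 1)) n, add_comm, ← integral_add
      (integrable_of_dependsOn_Iio hdep _) (integrable_of_dependsOn_Iio (hh n) _)]
    refine integral_mono ((integrable_of_dependsOn_Iio hdep _).add
      (integrable_of_dependsOn_Iio (hh n) _)) (integrable_of_dependsOn_Iio (hφ n) _) ?_
    exact drift n (by omega)

end Resampling

variable {K : ℕ}

/-! ### The law of one step -/

/-- The law of the randomness of one step. -/
noncomputable def stepLaw (B : ClickBandit K) : Measure (Outcome K) :=
  B.law.prod (PMF.uniformOfFintype (Fin (K - 1) → Bool)).toMeasure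

instance (B : ClickBandit K) : IsProbabilityMeasure (stepLaw B) := by
  unfold stepLaw; infer_instance

lemma experiment_eq (B : ClickBandit K) :
    experiment B = Measure.infinitePi fun _ : ℕ => stepLaw B := rfl

instance (B : ClickBandit K) : IsProbabilityMeasure (experiment B) := by
  rw [experiment_eq]; infer_instance

/-- The average over the coins. -/
noncomputable def coinMean (G : (Fin (K - 1) → Bool) → ℝ) : ℝ :=
  ∫ c, G c ∂(PMF.uniformOfFintype (Fin (K - 1) → Bool)).toMeasure

lemma coinMean_mono {G H : (Fin (K - 1) → Bool) → ℝ} (h : ∀ c, G c ≤ H c) :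
    coinMean G ≤ coinMean H :=
  integral_mono Integrable.of_finite Integrable.of_finite h

lemma coinMean_const (a : ℝ) : coinMean (fun _ : Fin (K - 1) → Bool => a) = a := by
  simp [coinMean]

lemma coinMean_turn (p : Fin (K - 1)) (G : (Fin (K - 1) → Bool) → ℝ) :
    coinMean (fun c => G (turn p c)) = coinMean G := by
  unfold coinMean
  rw [PMF.integral_eq_sum, PMF.integral_eq_sum]
  simp only [PMF.uniformOfFintype_apply]
  exact Equiv.sum_comp (turn_involutive p).toPerm fun c => ((Fintype.card _ : ENNReal)⁻¹).toReal • G c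

lemma coinMean_add (G H : (Fin (K - 1) → Bool) → ℝ) :
    coinMean (fun c => G c + H c) = coinMean G + coinMean H :=
  integral_add Integrable.of_finite Integrable.of_finite

lemma integral_click (B : ClickBandit K) (R : RankedList K) (k : Fin K) :
    ∫ w, (click w.1 w.2 R k : ℝ) ∂B.law = B.χ R k * B.α (R k) := by
  have := B.factor R k
  unfold ClickBandit.χ ClickBandit.α
  rw [← this]
  have he : (fun w : AttractionVec K × ExaminationMat K => (click w.1 w.2 R k : ℝ))
      = Set.indicator {w | w.1 (R k) = true ∧ w.2 R k = true} 1 := by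
    ext w
    simp only [click, Set.indicator, Set.mem_ofPred_eq, Pi.one_apply]
    split_ifs <;> simp_all
  rw [he, integral_indicator_one (Set.toFinite _).measurableSet]

lemma integral_click_item (B : ClickBandit K) (δ : ℝ) (t : ℕ) (S : State K) (i : Fin K) :
    ∫ w, (click w.1.1 w.1.2 (display δ t S w.2) ((display δ t S w.2).symm i) : ℝ) ∂(stepLaw B)
      = B.α i * coinMean fun c => B.χ (display δ t S c) ((display δ t S c).symm i) := by
  unfold stepLaw coinMean
  rw [integral_prod_symm _ Integrable.of_finite, ← integral_const_mul]
  congr 1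
  ext c
  simp only [integral_click, Equiv.apply_symm_apply]
  ring

variable {B : ClickBandit K}

lemma χ_nonneg (R : RankedList K) (k : Fin K) : 0 ≤ B.χ R k := measureReal_nonneg
lemma χ_le_one (R : RankedList K) (k : Fin K) : B.χ R k ≤ 1 := measureReal_le_one
lemma α_le_one (i : Fin K) : B.α i ≤ 1 := measureReal_le_one

lemma χmin_le [NeZero K] (hB : B.Assumptions) (R : RankedList K) (k : Fin K) :
    χmin B ≤ B.χ R k := by
  refine le_trans ?_ (hB.A5 R k)
  unfold χmin
  rcases eq_or_ne k ⟨K - 1, Nat.sub_lt (NeZero.pos K) Nat.one_pos⟩ with rfl | h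
  · exact le_rfl
  · refine hB.A3 1 _ _ ?_
    rw [Fin.lt_def]
    have := k.2
    simp only [ne_eq, Fin.ext_iff] at h
    simp only
    omega

lemma χ_one_le_χmax [NeZero K] (hB : B.Assumptions) (k : Fin K) : B.χ 1 k ≤ χmax B := by
  unfold χmax
  rcases eq_or_ne k 0 with rfl | h
  · exact le_rfl
  · exact hB.A3 1 _ _ (Fin.pos_iff_ne_zero.2 h)

/-- Within a handled pair, the better item is examined on average at least as often. -/
lemma coinMean_χ_le [NeZero K] (hB : B.Assumptions) (hα : StrictAnti B.α) {δ : ℝ} {t : ℕ}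
    {S : State K} (hS : Good δ S) {i j : Fin K} (hij : i < j)
    (hp : Paired t (S.base.symm i) (S.base.symm j)) :
    coinMean (fun c => B.χ (display δ t S c) ((display δ t S c).symm j))
      ≤ coinMean fun c => B.χ (display δ t S c) ((display δ t S c).symm i) := by
  obtain ⟨p, hsp, hp⟩ := (paired_symm_iff S.base i j).1 hp
  -- If the coin is suppressed, `Good` forces the better item to be on top, and A3 suffices.
  by_cases hc : Confident δ S.s S.n (S.base (lo p)) (S.base (hi p))
  · rcases hp with ⟨h1, h2⟩ | ⟨h1, h2⟩
    · refine coinMean_mono fun c => ?_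
      rcases display_slot δ t S c hsp with h | h
      · have e1 : (display δ t S c).symm i = lo p := by
          rw [Equiv.symm_apply_eq, h.1, h1]
        have e2 : (display δ t S c).symm j = hi p := by
          rw [Equiv.symm_apply_eq, h.2, h2]
        rw [e1, e2]
        exact hB.A3 _ _ _ (lo_lt_hi p)
      · exact absurd hc h.1.2.1
    · exact absurd hc (by rw [← h1, ← h2]; exact hS i j hij)
  -- Otherwise average each coin vector with its turned version. The upper position is equally
  -- examined in both lists by A2, and the lower one is examined at least as often when it holds the
  -- better item by A4.
  · have hsum : ∀ k, coinMean (fun c => B.χ (display δ t S c) ((display δ t S c).symm k)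
        + B.χ (display δ t S (turn p c)) ((display δ t S (turn p c)).symm k))
        = 2 * coinMean fun c => B.χ (display δ t S c) ((display δ t S c).symm k) := fun k => by
      rw [coinMean_add,
        coinMean_turn p fun c => B.χ (display δ t S c) ((display δ t S c).symm k)]
      ring
    have key : ∀ R : RankedList K, R (lo p) = i → R (hi p) = j →
        B.χ R (R.symm j) + B.χ (R * Equiv.swap (lo p) (hi p))
            ((R * Equiv.swap (lo p) (hi p)).symm j)
          ≤ B.χ R (R.symm i) + B.χ (R * Equiv.swap (lo p) (hi p))
            ((R * Equiv.swap (lo p) (hi p)).symm i) := by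
      intro R h1 h2
      have e1 : R.symm i = lo p := by rw [Equiv.symm_apply_eq, h1]
      have e2 : R.symm j = hi p := by rw [Equiv.symm_apply_eq, h2]
      rw [mul_swap_symm_apply, mul_swap_symm_apply, e1, e2, Equiv.swap_apply_left,
        Equiv.swap_apply_right]
      have a2 : B.χ R (lo p) = B.χ (R * Equiv.swap (lo p) (hi p)) (lo p) := by
        refine hB.A2 _ _ _ (Set.image_congr fun q hq => ?_)
        rw [Equiv.Perm.mul_apply, Equiv.swap_apply_of_ne_of_ne (ne_of_lt hq)
          (ne_of_lt (lt_trans hq (lo_lt_hi p)))]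
      have a4 := hB.A4 (R * Equiv.swap (lo p) (hi p)) (lo p) (hi p) (lo_lt_hi p) (by
        simpa [h1, h2] using (hα hij).le)
      rw [mul_assoc, Equiv.swap_mul_self, mul_one] at a4
      linarith
    have := coinMean_mono (G := fun c => B.χ (display δ t S c) ((display δ t S c).symm j)
        + B.χ (display δ t S (turn p c)) ((display δ t S (turn p c)).symm j))
      (H := fun c => B.χ (display δ t S c) ((display δ t S c).symm i)
        + B.χ (display δ t S (turn p c)) ((display δ t S (turn p c)).symm i)) fun c => by
      have hd := display_turn δ t S c hsp hc
      have hab : (display δ t S c (lo p) = i ∧ display δ t S c (hi p) = j) ∨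
          (display δ t S c (lo p) = j ∧ display δ t S c (hi p) = i) := by
        rcases display_slot δ t S c hsp with ⟨a, b⟩ | ⟨-, a, b⟩ <;>
          rcases hp with ⟨h1, h2⟩ | ⟨h1, h2⟩ <;> simp [a, b, h1, h2]
      rcases hab with ⟨a, b⟩ | ⟨a, b⟩
      · have := key _ a b
        rwa [← hd] at this
      · have hd' : display δ t S c = display δ t S (turn p c) * Equiv.swap (lo p) (hi p) := by
          rw [hd, mul_assoc, Equiv.swap_mul_self, mul_one]
        have := key (display δ t S (turn p c)) (by rw [hd]; simp [b]) (by rw [hd]; simp [a])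
        rw [← hd'] at this
        linarith
    rw [hsum, hsum] at this
    linarith

/-- The law of the change of the statistics of a handled pair. -/
lemma exists_clickDiff_law [NeZero K] (hB : B.Assumptions) (hα : StrictAnti B.α)
    (hα_pos : ∀ i, 0 < B.α i) {δ : ℝ} {t : ℕ}
    {S : State K} (hS : Good δ S) {i j : Fin K} (hij : i < j)
    (hp : Paired t (S.base.symm i) (S.base.symm j)) :
    ∃ u v : ℝ, 0 ≤ u ∧ 0 ≤ v ∧ χmin B * (B.α i - B.α j) ≤ u - v ∧
      (B.α i - B.α j) / (B.α i + B.α j) * (u + v) ≤ u - v ∧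
      ∀ ψ : ℤ → ℝ, ψ 0 = 0 →
        ∫ w, ψ (clickDiff δ t S i j w) ∂(stepLaw B) = u * ψ 1 + v * ψ (-1) := by
  set x := coinMean fun c => B.χ (display δ t S c) ((display δ t S c).symm i) with hx
  set y := coinMean fun c => B.χ (display δ t S c) ((display δ t S c).symm j) with hy
  have hyx : y ≤ x := coinMean_χ_le hB hα hS hij hp
  have hym : χmin B ≤ y := by
    rw [← coinMean_const (K := K) (χmin B)]
    exact coinMean_mono fun c => χmin_le hB _ _
  set u := (stepLaw B).real {w | clickDiff δ t S i j w = 1} with hu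
  set v := (stepLaw B).real {w | clickDiff δ t S i j w = -1} with hv
  have law : ∀ ψ : ℤ → ℝ, ψ 0 = 0 →
      ∫ w, ψ (clickDiff δ t S i j w) ∂(stepLaw B) = u * ψ 1 + v * ψ (-1) := by
    intro ψ h0
    have he : (fun w => ψ (clickDiff δ t S i j w)) = fun w =>
        Set.indicator {w | clickDiff δ t S i j w = 1} (fun _ => ψ 1) w
        + Set.indicator {w | clickDiff δ t S i j w = -1} (fun _ => ψ (-1)) w := by
      ext w
      rcases clickDiff_cases δ t S i j w with h | h | h <;> simp [h, h0]
    rw [he, integral_add Integrable.of_finite Integrable.of_finite,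
      integral_indicator_const _ (Set.toFinite _).measurableSet,
      integral_indicator_const _ (Set.toFinite _).measurableSet, smul_eq_mul, smul_eq_mul]
  have hdiff : u - v = B.α i * x - B.α j * y := by
    have h1 := law (fun z => (z : ℝ)) (by simp)
    rw [hx, hy, ← integral_click_item, ← integral_click_item,
      ← integral_sub Integrable.of_finite Integrable.of_finite]
    simp only [clickDiff] at h1
    push_cast at h1
    linarith
  -- Exactly one click is no likelier than the sum of the two click probabilities.
  have hsum : u + v ≤ B.α i * x + B.α j * y := by
    have h1 := law (fun z => |(z : ℝ)|) (by simp)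
    rw [hx, hy, ← integral_click_item, ← integral_click_item,
      ← integral_add Integrable.of_finite Integrable.of_finite]
    have h2 : u + v = ∫ w, |(clickDiff δ t S i j w : ℝ)| ∂(stepLaw B) := by
      rw [h1]; simp
    rw [h2]
    refine integral_mono Integrable.of_finite Integrable.of_finite fun w => ?_
    simp only [clickDiff]
    rcases click_cases w.1.1 w.1.2 (display δ t S w.2) ((display δ t S w.2).symm i) with h | h <;>
    rcases click_cases w.1.1 w.1.2 (display δ t S w.2) ((display δ t S w.2).symm j) with h' | h' <;>
    rw [h, h'] <;> norm_num
  have hgap := hα hij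
  have hi := hα_pos i
  have hj := hα_pos j
  refine ⟨u, v, measureReal_nonneg, measureReal_nonneg, ?_, ?_, law⟩
  · rw [hdiff]; nlinarith
  · have hρ : 0 ≤ (B.α i - B.α j) / (B.α i + B.α j) :=
      div_nonneg (by linarith) (by linarith)
    refine (mul_le_mul_of_nonneg_left hsum hρ).trans ?_
    rw [hdiff, div_mul_eq_mul_div, div_le_iff₀ (by linarith)]
    -- After clearing denominators the difference of the two sides is 2 α(i) α(j) (x - y).
    nlinarith [mul_nonneg (mul_nonneg hi.le hj.le) (sub_nonneg.2 hyx)]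

end BubbleRank

namespace BubbleRank

variable {K : ℕ}

/-! ### Replacing the last step of a history -/

/-- The pairs of items in increasing order. -/
def ltPairs (K : ℕ) : Finset (Fin K × Fin K) := Finset.univ.filter fun e => e.1 < e.2

lemma card_ltPairs_le (K : ℕ) : (ltPairs K).card ≤ K ^ 2 := by
  refine (Finset.card_filter_le _ _).trans ?_
  simp [sq]

section Update

variable (δ : ℝ) (R₀ : RankedList K) (ω : ℕ → Outcome K) (t : ℕ) (w : Outcome K)

lemma stateAfter_update {u : ℕ} (hu : u ≤ t) :
    stateAfter δ R₀ (Function.update ω t w) u = stateAfter δ R₀ ω u :=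
  stateAfter_congr (t := t) (fun v hv => by rw [Function.update_of_ne hv.ne]) u hu

lemma stateAfter_update_succ :
    stateAfter δ R₀ (Function.update ω t w) (t + 1) = step δ (t + 1) (stateAfter δ R₀ ω t) w := by
  rw [stateAfter, stateAfter_update δ R₀ ω t w le_rfl, Function.update_self]

lemma alive_succ_iff : Alive δ R₀ ω (t + 1) ↔
    Alive δ R₀ ω t ∧ Good δ (stateAfter δ R₀ ω (t + 1)) := by
  unfold Alive
  constructor
  · exact fun h => ⟨fun u hu => h u (by omega), h _ le_rfl⟩
  · rintro ⟨h1, h2⟩ u hu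
    rcases Nat.le_succ_iff.1 hu with hu | rfl
    · exact h1 u hu
    · exact h2

lemma alive_update_succ_iff : Alive δ R₀ (Function.update ω t w) (t + 1) ↔
    Alive δ R₀ ω t ∧ Good δ (step δ (t + 1) (stateAfter δ R₀ ω t) w) := by
  rw [alive_succ_iff, stateAfter_update_succ]
  refine and_congr_left fun _ => ?_
  unfold Alive
  exact forall₂_congr fun u hu => by rw [stateAfter_update δ R₀ ω t w hu]

lemma seenPairs_update_succ : seenPairs δ R₀ (Function.update ω t w) (t + 1) =
    seenPairs δ R₀ ω t ∪ adjPairs (step δ (t + 1) (stateAfter δ R₀ ω t) w).base := by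
  rw [seenPairs_succ, stateAfter_update_succ]
  congr 1
  unfold seenPairs
  refine Finset.biUnion_congr rfl fun u hu => ?_
  rw [stateAfter_update δ R₀ ω t w (by simpa [Nat.lt_succ_iff] using hu)]

end Update

lemma stateAfter_dependsOn (δ : ℝ) (R₀ : RankedList K) (t : ℕ) :
    DependsOn (fun ω => stateAfter δ R₀ ω t) (Set.Iio t) :=
  fun _ _ h => stateAfter_congr h t le_rfl

lemma alive_dependsOn (δ : ℝ) (R₀ : RankedList K) (t : ℕ) :
    DependsOn (fun ω => Alive δ R₀ ω t) (Set.Iio t) := by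
  intro ω ω' h
  unfold Alive
  exact propext (forall₂_congr fun u hu => by rw [stateAfter_congr h u hu])

lemma seenPairs_dependsOn (δ : ℝ) (R₀ : RankedList K) (t : ℕ) :
    DependsOn (fun ω => seenPairs δ R₀ ω t) (Set.Iio t) := by
  intro ω ω' h
  unfold seenPairs
  refine Finset.biUnion_congr rfl fun u hu => ?_
  rw [stateAfter_congr h u (by simpa [Nat.lt_succ_iff] using hu)]

lemma alive_zero (δ : ℝ) (R₀ : RankedList K) (ω : ℕ → Outcome K) : Alive δ R₀ ω 0 := by
  intro u hu
  obtain rfl : u = 0 := by omega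
  intro i j _
  simp [Confident, stateAfter, init]

/-! ### The failure probability -/

variable {B : ClickBandit K}

/-- The supermartingale property, from `exp_drift`. The compensator uses n(i,j), which grows exactly
when s(i,j) moves. -/
lemma integral_exp_step_le [NeZero K] (hB : B.Assumptions) (hα : StrictAnti B.α)
    (hα_pos : ∀ i, 0 < B.α i) (hχ : 0 < χmin B) {δ : ℝ} {S : State K} (hS : Good δ S) (t : ℕ)
    {i j : Fin K} (hij : i < j) {μ : ℝ} (hμ : 0 ≤ μ) :
    ∫ w, Real.exp (-μ * (step δ t S w).s i j - μ ^ 2 / 2 * (step δ t S w).n i j) ∂(stepLaw B)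
      ≤ Real.exp (-μ * S.s i j - μ ^ 2 / 2 * S.n i j) := by
  by_cases hp : Paired t (S.base.symm i) (S.base.symm j)
  · obtain ⟨u, v, -, hv, h1, -, law⟩ := exists_clickDiff_law hB hα hα_pos hS hij hp
    have hvu : v ≤ u := by
      have := mul_pos hχ (sub_pos.2 (hα hij))
      linarith
    have e := law (fun d => Real.exp (-μ * d - μ ^ 2 / 2 * |d|) - 1) (by simp)
    rw [integral_sub Integrable.of_finite Integrable.of_finite] at e
    have hd := exp_drift hvu hv hμ
    have hE : ∀ w, Real.exp (-μ * (step δ t S w).s i j - μ ^ 2 / 2 * (step δ t S w).n i j)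
        = Real.exp (-μ * S.s i j - μ ^ 2 / 2 * S.n i j)
          * Real.exp (-μ * clickDiff δ t S i j w - μ ^ 2 / 2 * |clickDiff δ t S i j w|) := by
      intro w
      obtain ⟨a, b⟩ := step_of_paired (δ := δ) hp w
      have b' : ((step δ t S w).n i j : ℝ) = S.n i j + |(clickDiff δ t S i j w : ℝ)| := by
        exact_mod_cast b
      rw [a, b', ← Real.exp_add]
      push_cast
      ring_nf
    simp only [hE]
    rw [integral_const_mul]
    refine mul_le_of_le_one_right (Real.exp_pos _).le ?_
    simp at e
    have e1 : -μ - μ ^ 2 / 2 = -μ + -(μ ^ 2 / 2) := by ring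
    have e2 : μ - μ ^ 2 / 2 = μ + -(μ ^ 2 / 2) := by ring
    simp only [sub_eq_add_neg] at e hd ⊢
    simp only [neg_mul, Int.cast_abs]
    linarith
  · simp [step_of_not_paired hp]

/-- With m = n(i,j) and μ = 2√(L/m), the threshold gives -μ s > 4L while the compensator costs 2L.
The surplus 2L is log(δ⁻²). -/
lemma one_le_exp_of_confident {δ : ℝ} (hδ0 : 0 < δ) (hδ1 : δ < 1) {t : ℕ} {S : State K}
    (hc : Consistent t S) {i j : Fin K} (h : Confident δ S.s S.n j i) :
    0 < S.n i j ∧ 1 ≤ δ ^ 2 * Real.exp (-(2 * √(Real.log (1 / δ) / S.n i j)) * S.s i j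
      - (2 * √(Real.log (1 / δ) / S.n i j)) ^ 2 / 2 * S.n i j) := by
  set L := Real.log (1 / δ) with hL
  have hLpos : 0 < L := Real.log_pos (by rw [lt_div_iff₀ hδ0]; linarith)
  have hs := hc.s_symm i j
  unfold Confident at h
  rw [← hL, hs, hc.n_symm i j] at h
  have hn : 0 < S.n i j := by
    rcases Nat.eq_zero_or_pos (S.n i j) with h0 | h0
    · have := hc.abs_s_le i j
      have hs0 : S.s i j = 0 := by
        rw [h0] at this
        simpa using this
      simp [h0, hs0] at h
    · exact h0
  refine ⟨hn, ?_⟩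
  set m : ℝ := (S.n i j : ℝ) with hm
  have hmpos : 0 < m := by rw [hm]; exact_mod_cast hn
  have h1 : √(L / m) * √(m * L) = L := by
    rw [← Real.sqrt_mul (by positivity)]
    have : L / m * (m * L) = L ^ 2 := by field_simp
    rw [this, Real.sqrt_sq hLpos.le]
  have h2 : √(L / m) ^ 2 * m = L := by
    rw [Real.sq_sqrt (by positivity)]
    field_simp
  have h3 : δ ^ 2 = Real.exp (-(2 * L)) := by
    have : δ = Real.exp (-L) := by
      rw [hL, one_div, Real.log_inv, neg_neg, Real.exp_log hδ0]
    rw [this, ← Real.exp_nat_mul]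
    push_cast
    ring_nf
  rw [h3, ← Real.exp_add]
  refine Real.one_le_exp ?_
  have h4 := mul_le_mul_of_nonneg_left h.le (Real.sqrt_nonneg (L / m))
  push_cast at h4
  nlinarith

open Classical in
/-- The probability that an inverted pair is ever believed to be in the right order. -/
lemma integral_not_alive_le [NeZero K] (hB : B.Assumptions) (hα : StrictAnti B.α)
    (hα_pos : ∀ i, 0 < B.α i) (hχ : 0 < χmin B) (R₀ : RankedList K) {δ : ℝ} (hδ0 : 0 < δ)
    (hδ1 : δ < 1) (n : ℕ) :
    ∫ ω, (if Alive δ R₀ ω n then 0 else 1 : ℝ) ∂(experiment B) ≤ δ ^ 2 * K ^ 2 * n := by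
  set L := Real.log (1 / δ) with hL
  -- The best μ depends on the count at the time of failure, which is random; summing over all its
  -- possible values m is a union bound.
  set Z : Fin K × Fin K → ℕ → State K → ℝ := fun e m S =>
    Real.exp (-(2 * √(L / m)) * S.s e.1 e.2 - (2 * √(L / m)) ^ 2 / 2 * S.n e.1 e.2) with hZ
  set Q : State K → ℝ := fun S => δ ^ 2 * ∑ e ∈ ltPairs K, ∑ m ∈ Finset.Icc 1 n, Z e m S with hQ
  have hQ0 : ∀ S, 0 ≤ Q S := fun S => mul_nonneg (sq_nonneg _)
    (Finset.sum_nonneg fun e _ => Finset.sum_nonneg fun m _ => (Real.exp_pos _).le)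
  -- Stopped at the first failure: the value is frozen at 1, which the sum already dominates at that
  -- moment.
  set φ : ℕ → (ℕ → Outcome K) → ℝ := fun t ω =>
    if Alive δ R₀ ω t then Q (stateAfter δ R₀ ω t) else 1 with hφ
  have hdep : ∀ t, DependsOn (φ t) (Set.Iio t) := fun t ω ω' h => by
    have h1 := stateAfter_dependsOn δ R₀ t h
    have h2 := alive_dependsOn δ R₀ t h
    simp only at h1 h2
    simp only [hφ, h1, h2]
  have drift := sum_integral_add_le_of_drift (stepLaw B) (φ := φ) (h := fun _ _ => 0) hdep
    (fun t ω ω' _ => rfl) (n := n) (by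
    intro t ht ω
    rw [add_zero]
    by_cases hal : Alive δ R₀ ω t
    · have hS : Good δ (stateAfter δ R₀ ω t) := hal t le_rfl
      have hpt : ∀ w, φ (t + 1) (Function.update ω t w)
          ≤ Q (step δ (t + 1) (stateAfter δ R₀ ω t) w) := by
        intro w
        simp only [hφ]
        rw [stateAfter_update_succ]
        split_ifs with h
        · exact le_rfl
        · rw [alive_update_succ_iff] at h
          have hg : ¬ Good δ (step δ (t + 1) (stateAfter δ R₀ ω t) w) := fun hg => h ⟨hal, hg⟩
          unfold Good at hg
          push Not at hg
          obtain ⟨i, j, hij, hc⟩ := hg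
          have hcons := (consistent_stateAfter δ R₀ ω t).step (δ := δ) (u := t + 1) w
          obtain ⟨h1, h2⟩ := one_le_exp_of_confident hδ0 hδ1 hcons hc
          refine h2.trans ?_
          simp only [hQ]
          refine mul_le_mul_of_nonneg_left ?_ (sq_nonneg _)
          have hm := hcons.n_le i j
          refine le_trans ?_ (Finset.single_le_sum (f := fun e => ∑ m ∈ Finset.Icc 1 n,
            Z e m (step δ (t + 1) (stateAfter δ R₀ ω t) w))
            (fun e _ => Finset.sum_nonneg fun m _ => (Real.exp_pos _).le)
            (show (i, j) ∈ ltPairs K by simp [ltPairs, hij]))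
          exact Finset.single_le_sum (f := fun m =>
            Z (i, j) m (step δ (t + 1) (stateAfter δ R₀ ω t) w))
            (fun m _ => (Real.exp_pos _).le)
            (Finset.mem_Icc.2 ⟨h1, by omega⟩)
      refine (integral_mono Integrable.of_finite Integrable.of_finite hpt).trans ?_
      simp only [hφ, if_pos hal, hQ]
      rw [integral_const_mul]
      refine mul_le_mul_of_nonneg_left ?_ (sq_nonneg _)
      rw [integral_finsetSum _ fun _ _ => Integrable.of_finite]
      refine Finset.sum_le_sum fun e he => ?_
      rw [integral_finsetSum _ fun _ _ => Integrable.of_finite]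
      refine Finset.sum_le_sum fun m _ => ?_
      exact integral_exp_step_le hB hα hα_pos hχ hS (t + 1)
        (by simpa [ltPairs] using he) (by positivity)
    · have : ∀ w, φ (t + 1) (Function.update ω t w) = 1 := fun w => by
        simp only [hφ]
        rw [if_neg]
        rw [alive_update_succ_iff]
        exact fun h => hal h.1
      simp only [this]
      simp [hφ, hal])
  simp only [integral_zero, Finset.sum_const_zero, zero_add] at drift
  rw [experiment_eq]
  have hdepA : DependsOn (fun ω => (if Alive δ R₀ ω n then 0 else 1 : ℝ)) (Set.Iio n) :=
    fun ω ω' h => by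
      have h2 := alive_dependsOn δ R₀ n h
      simp only at h2
      simp only [h2]
  refine (integral_mono (integrable_of_dependsOn_Iio hdepA _)
    (integrable_of_dependsOn_Iio (hdep n) _) fun ω => ?_).trans (drift.trans ?_)
  · simp only [hφ]
    split_ifs
    · exact hQ0 _
    · exact le_rfl
  · have h0 : ∀ ω, φ 0 ω = δ ^ 2 * ((ltPairs K).card * n) := fun ω => by
      simp only [hφ, if_pos (alive_zero δ R₀ ω), hQ, hZ]
      simp [stateAfter, init]
    simp only [h0, integral_const, probReal_univ, one_smul]
    have := card_ltPairs_le K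
    have : ((ltPairs K).card : ℝ) ≤ (K : ℝ) ^ 2 := by exact_mod_cast this
    rw [mul_assoc]
    gcongr

/-! ### The evidence potential -/

/-- The relative gap of two items. -/
noncomputable def relGap (B : ClickBandit K) (e : Fin K × Fin K) : ℝ :=
  (B.α e.1 - B.α e.2) / (B.α e.1 + B.α e.2)

/-- The evidence gathered on a pair of items. -/
noncomputable def evidence (B : ClickBandit K) (L : ℝ) (e : Fin K × Fin K) (S : State K) : ℝ :=
  saturate (2 * L / relGap B e) (relGap B e / 5) (S.s e.1 e.2 - relGap B e / 2 * S.n e.1 e.2)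

open Classical in
/-- The gap of a pair that is handled at time `t` and about which no confidence is reached. -/
noncomputable def activeGap (B : ClickBandit K) (δ : ℝ) (t : ℕ) (S : State K)
    (e : Fin K × Fin K) : ℝ :=
  if Paired t (S.base.symm e.1) (S.base.symm e.2) ∧ ¬ Confident δ S.s S.n e.1 e.2 then
    B.α e.1 - B.α e.2 else 0

lemma relGap_pos (hα : StrictAnti B.α) (hα_pos : ∀ i, 0 < B.α i) {e : Fin K × Fin K}
    (he : e.1 < e.2) : 0 < relGap B e :=
  div_pos (sub_pos.2 (hα he)) (add_pos (hα_pos _) (hα_pos _))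

lemma relGap_le_one (hα_pos : ∀ i, 0 < B.α i) (e : Fin K × Fin K) : relGap B e ≤ 1 := by
  have h1 := hα_pos e.1
  have h2 := hα_pos e.2
  unfold relGap
  rw [div_le_one (by linarith)]
  linarith

-- The threshold of `saturate` is placed so that an undecided pair always lies in the linear range,
-- where the drift is at least a quarter of χmin times the gap. Decided or idle pairs lose nothing
-- on average.
open Classical in
lemma integral_evidence_step [NeZero K] (hB : B.Assumptions) (hα : StrictAnti B.α)
    (hα_pos : ∀ i, 0 < B.α i) {δ : ℝ} (hδ0 : 0 < δ)
    (hδ1 : δ < 1) {S : State K} (hS : Good δ S) (t : ℕ) {e : Fin K × Fin K} (he : e.1 < e.2) :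
    evidence B (Real.log (1 / δ)) e S + χmin B / 4 * activeGap B δ t S e
      ≤ ∫ w, evidence B (Real.log (1 / δ)) e (step δ t S w) ∂(stepLaw B) := by
  obtain ⟨i, j⟩ := e
  simp only at he
  set L := Real.log (1 / δ) with hL
  have hLpos : 0 < L := Real.log_pos (by rw [lt_div_iff₀ hδ0]; linarith)
  unfold evidence activeGap
  have hρ0 := relGap_pos (e := (i, j)) hα hα_pos he
  have hρ1 := relGap_le_one hα_pos (i, j)
  by_cases hp : Paired t (S.base.symm i) (S.base.symm j)
  · obtain ⟨u, v, hu, hv, h1, h2, law⟩ := exists_clickDiff_law hB hα hα_pos hS he hp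
    change relGap B (i, j) * (u + v) ≤ u - v at h2
    set ρ := relGap B (i, j) with hρ
    have hd := saturate_drift (b := 2 * L / ρ) hρ0 hρ1 hu hv h2 (S.s i j - ρ / 2 * S.n i j)
    have e1 := law (fun d => saturate (2 * L / ρ) (ρ / 5)
      (S.s i j - ρ / 2 * S.n i j + (d - ρ / 2 * |d|))
      - saturate (2 * L / ρ) (ρ / 5) (S.s i j - ρ / 2 * S.n i j)) (by simp)
    rw [integral_sub Integrable.of_finite Integrable.of_finite] at e1
    simp only [Int.cast_one, abs_one, mul_one, Int.cast_neg, abs_neg, integral_const,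
      probReal_univ, one_smul] at e1
    have hE : ∀ w, (((step δ t S w).s i j : ℝ) - ρ / 2 * (step δ t S w).n i j)
        = S.s i j - ρ / 2 * S.n i j
          + (clickDiff δ t S i j w - ρ / 2 * |clickDiff δ t S i j w|) := by
      intro w
      obtain ⟨a, b⟩ := step_of_paired (δ := δ) hp w
      have b' : ((step δ t S w).n i j : ℝ) = S.n i j + |(clickDiff δ t S i j w : ℝ)| := by
        exact_mod_cast b
      rw [a, b']
      push_cast
      ring
    simp only [hE, hp, true_and]
    rw [← e1] at hd
    have hact : (if ¬ Confident δ S.s S.n i j then χmin B / 4 * (B.α i - B.α j) else 0)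
        ≤ if (S.s i j : ℝ) - ρ / 2 * S.n i j ≤ 2 * L / ρ then (u - v) / 4 else 0 := by
      by_cases hc : Confident δ S.s S.n i j
      · rw [if_neg (not_not.2 hc)]
        have := mul_nonneg hρ0.le (add_nonneg hu hv)
        split_ifs
        · linarith
        · exact le_rfl
      · rw [if_pos hc, if_pos]
        · linarith
        · unfold Confident at hc
          push Not at hc
          have hn : (0 : ℝ) ≤ S.n i j := Nat.cast_nonneg _
          have hx : ρ / 2 * S.n i j * (2 * L / ρ) = S.n i j * L := by field_simp
          -- Arithmetic-geometric mean inequality: s ≤ 2√(nL) becomes s - (ρ/2) n ≤ 2L/ρ.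
          have hy : √(S.n i j * L) ≤ (ρ / 2 * S.n i j + 2 * L / ρ) / 2 := by
            rw [Real.sqrt_le_iff]
            refine ⟨by positivity, ?_⟩
            rw [← hx]
            nlinarith [sq_nonneg (ρ / 2 * S.n i j - 2 * L / ρ)]
          linarith
    have hmul : χmin B / 4 * (if ¬ Confident δ S.s S.n i j then B.α i - B.α j else 0)
        = if ¬ Confident δ S.s S.n i j then χmin B / 4 * (B.α i - B.α j) else 0 := by
      split_ifs <;> simp
    rw [hmul]
    linarith
  · simp [step_of_not_paired hp, hp]

open Classical in
/-- The expected total gap of the active pairs, before the first failure. -/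
lemma sum_integral_activeGap_le [NeZero K] (hB : B.Assumptions) (hα : StrictAnti B.α)
    (hα_pos : ∀ i, 0 < B.α i) (R₀ : RankedList K) {δ : ℝ} (hδ0 : 0 < δ)
    (hδ1 : δ < 1) (n : ℕ) {C : ℝ}
    (hC : ∀ e ∈ ltPairs K, (2 * Real.log (1 / δ) + 5) / relGap B e ≤ C) (hC0 : 0 ≤ C) :
    ∑ t ∈ Finset.range n, ∫ ω, (if Alive δ R₀ ω t then
        χmin B / 4 * ∑ e ∈ ltPairs K, activeGap B δ (t + 1) (stateAfter δ R₀ ω t) e else 0)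
        ∂(experiment B)
      ≤ C * ((K : ℝ) - 1 + 2 * (incorrectPairs R₀).card) := by
  set L := Real.log (1 / δ) with hL
  have hLpos : 0 < L := Real.log_pos (by rw [lt_div_iff₀ hδ0]; linarith)
  have hev : ∀ e : Fin K × Fin K, e.1 < e.2 → ∀ S, evidence B L e S ≤ C := by
    intro e he S
    have hρ0 := relGap_pos (e := e) hα hα_pos he
    refine (saturate_le (by positivity) _).trans (le_trans (le_of_eq ?_) (hC e (by
      simpa [ltPairs] using he)))
    field_simp
  have hev0 : ∀ e : Fin K × Fin K, e.1 < e.2 → ∀ S : State K, S.s e.1 e.2 = 0 →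
      S.n e.1 e.2 = 0 → evidence B L e S = 0 := by
    intro e he S h1 h2
    have hρ0 := relGap_pos (e := e) hα hα_pos he
    unfold evidence
    rw [h1, h2]
    simpa using saturate_zero (by positivity)
  -- Each seen pair holds its missing evidence, each inversion a reserve 2C that pays for the two
  -- neighbours its removal may create. Dropping to 0 after failure is harmless, since φ is
  -- nonnegative.
  set φ : ℕ → (ℕ → Outcome K) → ℝ := fun t ω =>
    if Alive δ R₀ ω t then
      ∑ e ∈ seenPairs δ R₀ ω t, (C - evidence B L e (stateAfter δ R₀ ω t))
        + 2 * C * (incorrectPairs (stateAfter δ R₀ ω t).base).card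
    else 0 with hφ
  have hdep : ∀ t, DependsOn (φ t) (Set.Iio t) := fun t ω ω' h => by
    have h1 := stateAfter_dependsOn δ R₀ t h
    have h2 := alive_dependsOn δ R₀ t h
    have h3 := seenPairs_dependsOn δ R₀ t h
    simp only at h1 h2 h3
    simp only [hφ, h1, h2, h3]
  have drift := sum_integral_add_le_of_drift (stepLaw B) (φ := φ) (h := fun t ω =>
      if Alive δ R₀ ω t then
        χmin B / 4 * ∑ e ∈ ltPairs K, activeGap B δ (t + 1) (stateAfter δ R₀ ω t) e else 0) hdep
    (fun t ω ω' h => by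
      have h1 := stateAfter_dependsOn δ R₀ t h
      have h2 := alive_dependsOn δ R₀ t h
      simp only at h1 h2
      simp only [h1, h2]) (n := n) (by
    intro t ht ω
    by_cases hal : Alive δ R₀ ω t
    · have hS : Good δ (stateAfter δ R₀ ω t) := hal t le_rfl
      set S := stateAfter δ R₀ ω t with hSdef
      set P := seenPairs δ R₀ ω t with hP
      have hPlt : ∀ e ∈ P, e.1 < e.2 := fun e he => seenPairs_lt he
      have hpt : ∀ w, φ (t + 1) (Function.update ω t w) ≤
          ∑ e ∈ P, (C - evidence B L e (step δ (t + 1) S w))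
            + 2 * C * (incorrectPairs S.base).card := by
        intro w
        simp only [hφ]
        rw [stateAfter_update_succ, seenPairs_update_succ, ← hSdef, ← hP]
        have hsum0 : 0 ≤ ∑ e ∈ P, (C - evidence B L e (step δ (t + 1) S w)) :=
          Finset.sum_nonneg fun e he => sub_nonneg.2 (hev e (hPlt e he) _)
        split_ifs with h
        · rw [alive_update_succ_iff] at h
          obtain ⟨⟨N, hN1, hN2⟩, -⟩ := base_improves h.2
          set S' := step δ (t + 1) S w with hS'
          have hsub : P ∪ adjPairs S'.base ⊆ P ∪ N := by
            intro e he
            have hPa := adjPairs_subset_seenPairs δ R₀ ω t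
            rw [← hP, ← hSdef] at hPa
            rcases Finset.mem_union.1 he with he | he
            · exact Finset.mem_union_left _ he
            · rcases Finset.mem_union.1 (hN1 he) with he | he
              · exact Finset.mem_union_left _ (hPa he)
              · exact Finset.mem_union_right _ he
          have hsd : ∑ e ∈ P ∪ adjPairs S'.base, (C - evidence B L e S')
              = ∑ e ∈ P, (C - evidence B L e S')
                + ∑ e ∈ (P ∪ adjPairs S'.base) \ P, (C - evidence B L e S') := by
            rw [add_comm, Finset.sum_sdiff Finset.subset_union_left]
          -- A pair that becomes adjacent only at the end of this step was not handled in it, so its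
          -- statistics are still zero and it costs exactly C.
          have hnew : ∑ e ∈ (P ∪ adjPairs S'.base) \ P, (C - evidence B L e S')
              ≤ N.card * C := by
            have hle : ∀ e ∈ (P ∪ adjPairs S'.base) \ P, C - evidence B L e S' ≤ C := by
              intro e he
              obtain ⟨he1, he2⟩ := Finset.mem_sdiff.1 he
              have helt : e.1 < e.2 := by
                rcases Finset.mem_union.1 he1 with he1 | he1
                · exact hPlt e he1
                · obtain ⟨p, -, rfl⟩ := Finset.mem_image.1 he1
                  exact adjPair_lt _ p
              have hz := eq_zero_of_not_mem_seenPairs (δ := δ) (R₀ := R₀) (ω := ω) helt he2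
              have hnp : ¬ Paired (t + 1) (S.base.symm e.1) (S.base.symm e.2) := fun hp =>
                he2 (adjPairs_subset_seenPairs _ _ _ _ (mem_adjPairs_of_paired helt hp))
              have hst := step_of_not_paired (δ := δ) hnp w
              rw [hev0 e helt S' (hst.1.trans hz.1) (hst.2.trans hz.2), sub_zero]
            refine (Finset.sum_le_sum hle).trans ?_
            rw [Finset.sum_const, nsmul_eq_mul]
            refine mul_le_mul_of_nonneg_right ?_ hC0
            have : (P ∪ adjPairs S'.base) \ P ⊆ N := by
              intro e he
              obtain ⟨he1, he2⟩ := Finset.mem_sdiff.1 he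
              exact (Finset.mem_union.1 (hsub he1)).resolve_left he2
            exact_mod_cast Finset.card_le_card this
          have hN2' : (N.card : ℝ) + 2 * (incorrectPairs S'.base).card
              ≤ 2 * (incorrectPairs S.base).card := by exact_mod_cast hN2
          rw [hsd]
          nlinarith
        · positivity
      have hint : ∫ w, φ (t + 1) (Function.update ω t w) ∂(stepLaw B) ≤
          ∑ e ∈ P, (C - ∫ w, evidence B L e (step δ (t + 1) S w) ∂(stepLaw B))
            + 2 * C * (incorrectPairs S.base).card := by
        refine (integral_mono Integrable.of_finite Integrable.of_finite hpt).trans (le_of_eq ?_)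
        rw [integral_add Integrable.of_finite Integrable.of_finite,
          integral_finsetSum _ fun _ _ => Integrable.of_finite]
        simp [integral_sub Integrable.of_finite Integrable.of_finite]
      have hgap : ∑ e ∈ ltPairs K, activeGap B δ (t + 1) S e
          = ∑ e ∈ P, activeGap B δ (t + 1) S e := by
        symm
        refine Finset.sum_subset (fun e he => by simpa [ltPairs] using hPlt e he) ?_
        intro e he he'
        unfold activeGap
        rw [if_neg]
        rintro ⟨hp, -⟩
        exact he' (adjPairs_subset_seenPairs _ _ _ _
          (mem_adjPairs_of_paired (by simpa [ltPairs] using he) hp))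
      have hcmp : ∑ e ∈ P, (C - ∫ w, evidence B L e (step δ (t + 1) S w) ∂(stepLaw B))
          + χmin B / 4 * ∑ e ∈ P, activeGap B δ (t + 1) S e
          ≤ ∑ e ∈ P, (C - evidence B L e S) := by
        rw [Finset.mul_sum, ← Finset.sum_add_distrib]
        refine Finset.sum_le_sum fun e he => ?_
        have := integral_evidence_step hB hα hα_pos hδ0 hδ1 hS (t + 1) (hPlt e he)
        linarith
      simp only [if_pos hal, hφ] at hint ⊢
      rw [hgap]
      linarith
    · have : ∀ w, φ (t + 1) (Function.update ω t w) = 0 := fun w => by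
        simp only [hφ]
        rw [if_neg]
        rw [alive_update_succ_iff]
        exact fun h => hal h.1
      simp only [this]
      simp [hφ, hal])
  rw [experiment_eq]
  have hφn : 0 ≤ ∫ ω, φ n ω ∂(Measure.infinitePi fun _ : ℕ => stepLaw B) := by
    refine integral_nonneg fun ω => ?_
    simp only [hφ, Pi.zero_apply]
    split_ifs
    · refine add_nonneg (Finset.sum_nonneg fun e he =>
        sub_nonneg.2 (hev e (seenPairs_lt he) _)) (by positivity)
    · exact le_rfl
  refine (le_trans (le_add_of_nonneg_right hφn) drift).trans ?_
  have h0 : ∀ ω, φ 0 ω = (adjPairs R₀).card * C + 2 * C * (incorrectPairs R₀).card := fun ω => by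
    simp only [hφ, if_pos (alive_zero δ R₀ ω)]
    have hseen : seenPairs δ R₀ ω 0 = adjPairs R₀ := by
      simp [seenPairs, stateAfter, init]
    rw [hseen]
    congr 1
    rw [← nsmul_eq_mul, ← Finset.sum_const]
    refine Finset.sum_congr rfl fun e he => ?_
    rw [hev0 e (by obtain ⟨p, -, rfl⟩ := Finset.mem_image.1 he; exact adjPair_lt _ p) _ rfl rfl,
      sub_zero]
  simp only [h0, integral_const, probReal_univ, one_smul]
  have hcard : ((adjPairs R₀).card : ℝ) ≤ (K : ℝ) - 1 := by
    have h1 := card_adjPairs_le R₀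
    have h2 : 1 ≤ K := NeZero.pos K
    have : ((adjPairs R₀).card : ℝ) ≤ ((K - 1 : ℕ) : ℝ) := by exact_mod_cast h1
    rwa [Nat.cast_sub h2, Nat.cast_one] at this
  nlinarith

end BubbleRank

namespace BubbleRank

variable {K : ℕ} {B : ClickBandit K}

/-! ### From regret to gaps of undecided pairs -/

/-- The increase of the attraction probability from position `p` to position `p + 1`. -/
noncomputable def rise (B : ClickBandit K) (R : RankedList K) (p : Fin (K - 1)) : ℝ :=
  max 0 (B.α (R (hi p)) - B.α (R (lo p)))

lemma sub_le_sum_rise (R : RankedList K) {a b : Fin K} (hab : a ≤ b) :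
    B.α (R b) - B.α (R a) ≤ ∑ p, rise B R p := by
  set g : ℕ → ℝ := fun m => if h : m < K then B.α (R ⟨m, h⟩) else 0 with hg
  have h1 : ∑ p, rise B R p = ∑ m ∈ Finset.range (K - 1), max 0 (g (m + 1) - g m) := by
    rw [← Fin.sum_univ_eq_sum_range (fun m => max 0 (g (m + 1) - g m))]
    refine Finset.sum_congr rfl fun p _ => ?_
    have := p.2
    simp only [rise, hg, lo, hi]
    rw [dif_pos (by omega), dif_pos (by omega)]
  have h2 : B.α (R b) - B.α (R a) = ∑ m ∈ Finset.Ico (a : ℕ) b, (g (m + 1) - g m) := by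
    rw [Finset.sum_Ico_eq_sub _ (Fin.le_def.1 hab), Finset.sum_range_sub, Finset.sum_range_sub]
    simp [hg]
  rw [h1, h2]
  refine (Finset.sum_le_sum fun m _ => le_max_right 0 _).trans ?_
  refine Finset.sum_le_sum_of_subset_of_nonneg (fun m hm => ?_) fun _ _ _ => le_max_left _ _
  have := b.2
  simp only [Finset.mem_Ico, Finset.mem_range] at hm ⊢
  omega

/-- Pigeonhole: there are more positions from k on than items beyond k. Going from k down to
position l, attraction must climb, so the rises pay for the loss at k. -/
lemma exists_le_of_position (R : RankedList K) (k : Fin K) : ∃ l, k ≤ l ∧ R l ≤ k := by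
  by_contra! h
  have hsub : (Finset.Ici k).image R ⊆ Finset.Ioi k := by
    intro x hx
    obtain ⟨l, hl, rfl⟩ := Finset.mem_image.1 hx
    exact Finset.mem_Ioi.2 (h l (Finset.mem_Ici.1 hl))
  have := Finset.card_le_card hsub
  rw [Finset.card_image_of_injective _ R.injective, Fin.card_Ici, Fin.card_Ioi] at this
  have := k.2
  omega

lemma sub_base_le (hα : StrictAnti B.α) (R : RankedList K) (k : Fin K) :
    B.α k - B.α (R k) ≤ ∑ p, rise B R p := by
  obtain ⟨l, hl, hlk⟩ := exists_le_of_position R k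
  have := hα.antitone hlk
  have := sub_le_sum_rise (B := B) R hl
  linarith

open Classical in
/-- The gap of the `p`-th pair of neighbours, if it may be exchanged in the display. -/
noncomputable def randomGap (B : ClickBandit K) (δ : ℝ) (t : ℕ) (S : State K)
    (p : Fin (K - 1)) : ℝ :=
  if Slot t p ∧ ¬ Confident δ S.s S.n (S.base (lo p)) (S.base (hi p)) then
    |B.α (S.base (lo p)) - B.α (S.base (hi p))| else 0

lemma randomGap_nonneg (δ : ℝ) (t : ℕ) (S : State K) (p : Fin (K - 1)) :
    0 ≤ randomGap B δ t S p := by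
  unfold randomGap
  split_ifs <;> positivity

lemma base_sub_display_le (δ : ℝ) (t : ℕ) (S : State K) (coin : Fin (K - 1) → Bool) (k : Fin K) :
    B.α (S.base k) - B.α (display δ t S coin k) ≤ ∑ p, randomGap B δ t S p := by
  obtain ⟨h1, h2⟩ := display_spec δ t S coin
  have hsum : ∀ p, randomGap B δ t S p ≤ ∑ p, randomGap B δ t S p := fun p =>
    Finset.single_le_sum (f := randomGap B δ t S) (fun q _ => randomGap_nonneg δ t S q)
      (Finset.mem_univ p)
  by_cases h : ∃ p, Flipped δ t S coin p ∧ (k = lo p ∨ k = hi p)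
  · obtain ⟨p, hp, hk⟩ := h
    refine le_trans ?_ (hsum p)
    unfold randomGap
    rw [if_pos ⟨hp.1, hp.2.1⟩]
    rcases hk with rfl | rfl
    · rw [(h1 p hp).1]
      exact le_abs_self _
    · rw [(h1 p hp).2, abs_sub_comm]
      exact le_abs_self _
  · push Not at h
    rw [h2 k h, sub_self]
    exact Finset.sum_nonneg fun q _ => randomGap_nonneg δ t S q

/-- `randomGap` tests confidence in the displayed order, `activeGap` in the true order. They differ
on inverted neighbours, where `hS` rules out confidence in the true order. -/
lemma sum_randomGap_le (hα : StrictAnti B.α) (δ : ℝ) (t : ℕ) (S : State K)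
    (hS : ∀ p, ¬ Confident δ S.s S.n (S.base (hi p)) (S.base (lo p))) :
    ∑ p, randomGap B δ t S p ≤ ∑ e ∈ ltPairs K, activeGap B δ t S e := by
  have h1 : ∀ p, randomGap B δ t S p ≤ activeGap B δ t S (adjPair S.base p) := by
    intro p
    have hne : S.base (lo p) ≠ S.base (hi p) := fun h => lo_ne_hi p (S.base.injective h)
    by_cases hp : Slot t p ∧ ¬ Confident δ S.s S.n (S.base (lo p)) (S.base (hi p))
    · unfold randomGap activeGap
      rw [if_pos hp]
      rcases lt_or_gt_of_ne hne with h | h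
      · rw [if_pos]
        · simp only [adjPair, min_eq_left h.le, max_eq_right h.le]
          rw [abs_of_pos (sub_pos.2 (hα h))]
        · simp only [adjPair, min_eq_left h.le, max_eq_right h.le]
          exact ⟨(paired_symm_iff _ _ _).2 ⟨p, hp.1, Or.inl ⟨rfl, rfl⟩⟩, hp.2⟩
      · rw [if_pos]
        · simp only [adjPair, min_eq_right h.le, max_eq_left h.le]
          rw [abs_sub_comm, abs_of_pos (sub_pos.2 (hα h))]
        · simp only [adjPair, min_eq_right h.le, max_eq_left h.le]
          exact ⟨(paired_symm_iff _ _ _).2 ⟨p, hp.1, Or.inr ⟨rfl, rfl⟩⟩, hS p⟩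
    · unfold randomGap activeGap
      rw [if_neg hp]
      split_ifs
      · exact (sub_pos.2 (hα (adjPair_lt _ p))).le
      · exact le_rfl
  refine (Finset.sum_le_sum fun p _ => h1 p).trans ?_
  rw [← Finset.sum_image (s := Finset.univ) (g := adjPair S.base) (f := activeGap B δ t S)
    fun p _ q _ h => adjPair_injective _ h]
  refine Finset.sum_le_sum_of_subset_of_nonneg (fun e he => ?_) fun e he _ => ?_
  · obtain ⟨p, -, rfl⟩ := Finset.mem_image.1 he
    simpa [ltPairs] using adjPair_lt S.base p
  · unfold activeGap
    split_ifs
    · exact (sub_pos.2 (hα (by simpa [ltPairs] using he))).le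
    · exact le_rfl

lemma activeGap_sum_nonneg (hα : StrictAnti B.α) (δ : ℝ) (t : ℕ) (S : State K) :
    0 ≤ ∑ e ∈ ltPairs K, activeGap B δ t S e := by
  refine Finset.sum_nonneg fun e he => ?_
  unfold activeGap
  split_ifs
  · exact (sub_pos.2 (hα (by simpa [ltPairs] using he))).le
  · exact le_rfl

/-- Inverted neighbours that are not handled now are handled in the next step, if the base list
does not change. -/
lemma rise_le (hα : StrictAnti B.α) {δ : ℝ} {t : ℕ} {S S' : State K} (hS : Good δ S)
    (hS' : Good δ S') (hb : S'.base = S.base) (p : Fin (K - 1)) :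
    rise B S.base p ≤ randomGap B δ t S p + randomGap B δ (t + 1) S' p := by
  have h0 := randomGap_nonneg (B := B) δ t S p
  have h0' := randomGap_nonneg (B := B) δ (t + 1) S' p
  unfold rise
  refine max_le (add_nonneg h0 h0') ?_
  by_cases h : S.base (hi p) < S.base (lo p)
  · have hslot : Slot t p ∨ Slot (t + 1) p := by unfold Slot; omega
    rcases hslot with hs | hs
    · have : randomGap B δ t S p = |B.α (S.base (lo p)) - B.α (S.base (hi p))| :=
        if_pos ⟨hs, hS _ _ h⟩
      rw [abs_sub_comm] at this
      have := le_abs_self (B.α (S.base (hi p)) - B.α (S.base (lo p)))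
      linarith
    · have : randomGap B δ (t + 1) S' p = |B.α (S'.base (lo p)) - B.α (S'.base (hi p))| :=
        if_pos ⟨hs, hS' _ _ (by rwa [hb])⟩
      rw [abs_sub_comm, hb] at this
      have := le_abs_self (B.α (S.base (hi p)) - B.α (S.base (lo p)))
      linarith
  · have := hα.antitone (not_lt.1 h)
    linarith

/-- By A5 the examination in R may be lowered to that in the optimal list, so only the attractions
differ. -/
lemma reward_sub_le [NeZero K] (hB : B.Assumptions) (R : RankedList K) {c : ℝ} (hc : 0 ≤ c)
    (h : ∀ k, B.α k - B.α (R k) ≤ c) : B.reward 1 - B.reward R ≤ K * χmax B * c := by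
  unfold ClickBandit.reward
  rw [← Finset.sum_sub_distrib]
  have : ∀ k ∈ Finset.univ, B.χ 1 k * B.α ((1 : RankedList K) k) - B.χ R k * B.α (R k)
      ≤ χmax B * c := by
    intro k _
    have h1 := hB.A5 R k
    have h2 : 0 ≤ B.α (R k) := measureReal_nonneg
    have h3 := χ_one_le_χmax hB k
    have h4 := χ_nonneg (B := B) 1 k
    rw [Equiv.Perm.one_apply]
    calc B.χ 1 k * B.α k - B.χ R k * B.α (R k)
        ≤ B.χ 1 k * B.α k - B.χ 1 k * B.α (R k) := by nlinarith
      _ = B.χ 1 k * (B.α k - B.α (R k)) := by ring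
      _ ≤ B.χ 1 k * c := mul_le_mul_of_nonneg_left (h k) h4
      _ ≤ χmax B * c := mul_le_mul_of_nonneg_right h3 hc
  refine (Finset.sum_le_sum this).trans (le_of_eq ?_)
  simp [mul_assoc]

lemma reward_sub_le_card (R : RankedList K) : B.reward 1 - B.reward R ≤ K := by
  unfold ClickBandit.reward
  rw [← Finset.sum_sub_distrib]
  refine (Finset.sum_le_sum (g := fun _ => (1 : ℝ)) fun k _ => ?_).trans (by simp)
  have h1 := χ_nonneg (B := B) R k
  have h2 : 0 ≤ B.α (R k) := measureReal_nonneg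
  have h3 := χ_le_one (B := B) 1 k
  have h4 := α_le_one (B := B) ((1 : RankedList K) k)
  have h5 : 0 ≤ B.α ((1 : RankedList K) k) := measureReal_nonneg
  have h6 := χ_nonneg (B := B) 1 k
  nlinarith [mul_nonneg h1 h2, mul_le_mul h3 h4 h5 zero_le_one]

open Classical in
/-- Indicator of a change of the base list in step `t`. -/
noncomputable def changed (δ : ℝ) (R₀ : RankedList K) (ω : ℕ → Outcome K) (t : ℕ) : ℝ :=
  if (stateAfter δ R₀ ω t).base = (stateAfter δ R₀ ω (t - 1)).base then 0 else 1

lemma changed_nonneg (δ : ℝ) (R₀ : RankedList K) (ω : ℕ → Outcome K) (t : ℕ) :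
    0 ≤ changed δ R₀ ω t := by
  unfold changed
  split_ifs <;> norm_num

/-- Before failure each change of the base list consumes an inversion. The term at time 0 vanishes
because 0 - 1 = 0. -/
lemma sum_changed_le {δ : ℝ} {R₀ : RankedList K} {ω : ℕ → Outcome K} {n : ℕ}
    (h : Alive δ R₀ ω n) : ∑ t ∈ Finset.range (n + 1), changed δ R₀ ω t
      + (incorrectPairs (stateAfter δ R₀ ω n).base).card ≤ (incorrectPairs R₀).card := by
  induction n with
  | zero => simp [changed, stateAfter, init]
  | succ n ih =>
    rw [alive_succ_iff] at h
    refine le_trans ?_ (ih h.1)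
    rw [Finset.sum_range_succ _ (n + 1), add_assoc]
    refine add_le_add_right ?_ _
    obtain ⟨-, himp⟩ := base_improves (t := n + 1) (w := ω n) h.2
    change (stateAfter δ R₀ ω (n + 1)).base = _ ∨
      (incorrectPairs (stateAfter δ R₀ ω (n + 1)).base).card < _ at himp
    unfold changed
    rw [Nat.add_sub_cancel]
    split_ifs with hb
    · rw [hb, zero_add]
    · have := himp.resolve_left hb
      have : (incorrectPairs (stateAfter δ R₀ ω (n + 1)).base).card + 1
        ≤ (incorrectPairs (stateAfter δ R₀ ω n).base).card := this
      rw [add_comm]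
      exact_mod_cast this

lemma not_confident_of_unchanged {δ : ℝ} {R₀ : RankedList K} {ω : ℕ → Outcome K} {t : ℕ}
    (h : Good δ (stateAfter δ R₀ ω t))
    (hb : (stateAfter δ R₀ ω t).base = (stateAfter δ R₀ ω (t - 1)).base) (p : Fin (K - 1)) :
    ¬ Confident δ (stateAfter δ R₀ ω t).s (stateAfter δ R₀ ω t).n
      ((stateAfter δ R₀ ω t).base (hi p)) ((stateAfter δ R₀ ω t).base (lo p)) := by
  cases t with
  | zero => simp [Confident, stateAfter, init]
  | succ t =>
    rw [Nat.add_sub_cancel] at hb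
    rw [hb]
    exact not_confident_of_bubble_eq h hb p

/-- Current gaps count twice, once for coin exchanges and once for rises in the pairs handled now;
the next step's gaps cover the rises of the other parity. If the base list changed just before or
after, the trivial loss 1 is charged to `changed`. -/
lemma regret_step_le [NeZero K] (hB : B.Assumptions) (hα : StrictAnti B.α) {δ : ℝ}
    {R₀ : RankedList K} {ω : ℕ → Outcome K} {t : ℕ} (h : Alive δ R₀ ω (t + 1)) :
    B.reward 1 - B.reward (displayed δ R₀ ω t) ≤ K * χmax B *
      (2 * ∑ e ∈ ltPairs K, activeGap B δ (t + 1) (stateAfter δ R₀ ω t) e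
        + ∑ e ∈ ltPairs K, activeGap B δ (t + 2) (stateAfter δ R₀ ω (t + 1)) e
        + changed δ R₀ ω t + changed δ R₀ ω (t + 1)) := by
  have n1 := activeGap_sum_nonneg hα δ (t + 1) (stateAfter δ R₀ ω t)
  have n2 := activeGap_sum_nonneg hα δ (t + 2) (stateAfter δ R₀ ω (t + 1))
  have n3 := changed_nonneg δ R₀ ω t
  have n4 := changed_nonneg δ R₀ ω (t + 1)
  refine reward_sub_le hB _ (by positivity) fun k => ?_
  have htriv : B.α k - B.α (displayed δ R₀ ω t k) ≤ 1 := by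
    have h1 := α_le_one (B := B) k
    have h2 : 0 ≤ B.α (displayed δ R₀ ω t k) := measureReal_nonneg
    linarith
  by_cases hb1 : (stateAfter δ R₀ ω t).base = (stateAfter δ R₀ ω (t - 1)).base
  · by_cases hb2 : (stateAfter δ R₀ ω (t + 1)).base = (stateAfter δ R₀ ω t).base
    · have g1 := h t (by omega)
      have g2 := h (t + 1) le_rfl
      have s1 := sum_randomGap_le (B := B) hα δ (t + 1) _ (not_confident_of_unchanged g1 hb1)
      have s2 := sum_randomGap_le (B := B) hα δ (t + 2) _ (not_confident_of_unchanged g2 hb2)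
      have d1 := sub_base_le hα (stateAfter δ R₀ ω t).base k
      have d2 := base_sub_display_le (B := B) δ (t + 1) (stateAfter δ R₀ ω t) (ω t).2 k
      have d3 := Finset.sum_le_sum fun p (_ : p ∈ Finset.univ) =>
        rise_le (t := t + 1) hα g1 g2 hb2 p
      rw [Finset.sum_add_distrib] at d3
      unfold displayed
      linarith
    · have : changed δ R₀ ω (t + 1) = 1 := if_neg hb2
      linarith
  · have : changed δ R₀ ω t = 1 := if_neg hb1
    linarith

open Classical in
lemma sum_regret_le [NeZero K] (hB : B.Assumptions) (hα : StrictAnti B.α) {δ : ℝ}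
    {R₀ : RankedList K} {ω : ℕ → Outcome K} {n : ℕ} :
    ∑ t ∈ Finset.range n, (B.reward 1 - B.reward (displayed δ R₀ ω t)) ≤
      K * n * (if Alive δ R₀ ω n then 0 else 1) + K * χmax B *
      (3 * ∑ t ∈ Finset.range (n + 1), (if Alive δ R₀ ω t then
        ∑ e ∈ ltPairs K, activeGap B δ (t + 1) (stateAfter δ R₀ ω t) e else 0)
        + 2 * (incorrectPairs R₀).card) := by
  have hχ0 : 0 ≤ χmax B := χ_nonneg _ _
  have hh0 : ∀ t, 0 ≤ (if Alive δ R₀ ω t then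
      ∑ e ∈ ltPairs K, activeGap B δ (t + 1) (stateAfter δ R₀ ω t) e else 0) := fun t => by
    split_ifs
    · exact activeGap_sum_nonneg hα _ _ _
    · exact le_rfl
  by_cases hal : Alive δ R₀ ω n
  · rw [if_pos hal, mul_zero, zero_add]
    have hal' : ∀ t ≤ n, Alive δ R₀ ω t := fun t ht u hu => hal u (hu.trans ht)
    have hsum := Finset.sum_le_sum fun t (ht : t ∈ Finset.range n) =>
      regret_step_le hB hα (hal' (t + 1) (by simpa using ht))
    refine hsum.trans ?_
    rw [← Finset.mul_sum]
    refine mul_le_mul_of_nonneg_left ?_ (by positivity)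
    have heq : ∑ t ∈ Finset.range (n + 1), (if Alive δ R₀ ω t then
        ∑ e ∈ ltPairs K, activeGap B δ (t + 1) (stateAfter δ R₀ ω t) e else 0)
        = ∑ t ∈ Finset.range (n + 1),
          ∑ e ∈ ltPairs K, activeGap B δ (t + 1) (stateAfter δ R₀ ω t) e :=
      Finset.sum_congr rfl fun t ht => if_pos (hal' t (by simpa [Nat.lt_succ_iff] using ht))
    rw [heq]
    simp only [Finset.sum_add_distrib, ← Finset.mul_sum]
    have c0 := sum_changed_le hal
    -- The shifted sums both embed in the sum over n + 1 terms, giving 2 + 1 = 3 copies of the gaps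
    -- and two copies of the number of changes.
    have a1 := Finset.sum_range_succ
      (fun t => ∑ e ∈ ltPairs K, activeGap B δ (t + 1) (stateAfter δ R₀ ω t) e) n
    have a2 := Finset.sum_range_succ'
      (fun t => ∑ e ∈ ltPairs K, activeGap B δ (t + 1) (stateAfter δ R₀ ω t) e) n
    have c1 := Finset.sum_range_succ (changed δ R₀ ω) n
    have c2 := Finset.sum_range_succ' (changed δ R₀ ω) n
    have p1 := activeGap_sum_nonneg hα δ (n + 1) (stateAfter δ R₀ ω n)
    have p2 := activeGap_sum_nonneg hα δ (0 + 1) (stateAfter δ R₀ ω 0)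
    have p3 := changed_nonneg δ R₀ ω n
    have p4 := changed_nonneg δ R₀ ω 0
    have p5 : (0 : ℝ) ≤ (incorrectPairs (stateAfter δ R₀ ω n).base).card := Nat.cast_nonneg _
    simp only [add_assoc, Nat.reduceAdd] at *
    linarith
  · rw [if_neg hal, mul_one]
    have h1 : ∑ t ∈ Finset.range n, (B.reward 1 - B.reward (displayed δ R₀ ω t)) ≤ K * n := by
      refine (Finset.sum_le_sum fun t _ => reward_sub_le_card _).trans ?_
      simp [mul_comm]
    have h2 := Finset.sum_nonneg fun t (_ : t ∈ Finset.range (n + 1)) => hh0 t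
    refine h1.trans (le_add_of_nonneg_right ?_)
    positivity

lemma displayed_dependsOn (δ : ℝ) (R₀ : RankedList K) (t : ℕ) :
    DependsOn (fun ω => displayed δ R₀ ω t) (Set.Iio (t + 1)) := by
  intro ω ω' h
  have h1 := stateAfter_congr (δ := δ) (R₀ := R₀) h t (by omega)
  have h2 : ω t = ω' t := h t (by simp)
  simp only [displayed, h1, h2]

lemma regret_eq (hB : B.Assumptions) (δ : ℝ) (R₀ : RankedList K) (n : ℕ) :
    regret B δ R₀ n = ∑ t ∈ Finset.range n,
      ∫ ω, (B.reward 1 - B.reward (displayed δ R₀ ω t)) ∂(experiment B) := by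
  have : Finset.univ.sup' Finset.univ_nonempty B.reward = B.reward 1 :=
    le_antisymm (Finset.sup'_le _ _ fun R _ => hB.A1 R)
      (Finset.le_sup' B.reward (Finset.mem_univ 1))
  simp only [regret, this]

lemma integrable_regret_step (δ : ℝ) (R₀ : RankedList K) (t : ℕ) :
    Integrable (fun ω => B.reward 1 - B.reward (displayed δ R₀ ω t)) (experiment B) := by
  refine integrable_of_dependsOn_Iio (t := t + 1) (fun ω ω' h => ?_) _
  have := displayed_dependsOn δ R₀ t h
  simp only at this
  simp only [this]

lemma regret_le_mul (hB : B.Assumptions) (δ : ℝ) (R₀ : RankedList K) (n : ℕ) :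
    regret B δ R₀ n ≤ K * n := by
  rw [regret_eq hB]
  refine (Finset.sum_le_sum (g := fun _ => (K : ℝ)) fun t _ => ?_).trans (by simp [mul_comm])
  refine (integral_mono (integrable_regret_step δ R₀ t) (integrable_const (K : ℝ))
    fun ω => reward_sub_le_card _).trans ?_
  simp

lemma Δmin_le_gap (hα : StrictAnti B.α) {i j : Fin K} (hij : i < j) :
    Δmin B ≤ B.α i - B.α j := by
  have hi1 : (i : ℕ) < K - 1 := by
    have := j.2
    have := Fin.lt_def.1 hij
    omega
  have h1 : Δmin B ≤ B.α (lo ⟨i, hi1⟩) - B.α (hi ⟨i, hi1⟩) :=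
    ciInf_le (Set.finite_range _).bddBelow _
  have h2 : B.α j ≤ B.α (hi ⟨i, hi1⟩) := hα.antitone (by
    rw [Fin.le_def]
    have := Fin.lt_def.1 hij
    simp only [hi]
    omega)
  have h3 : lo ⟨i, hi1⟩ = i := rfl
  rw [h3] at h1
  linarith

lemma Δmin_pos (hα : StrictAnti B.α) (hK : 2 ≤ K) : 0 < Δmin B := by
  have : Nonempty (Fin (K - 1)) := ⟨⟨0, by omega⟩⟩
  obtain ⟨p, hp⟩ := exists_eq_ciInf_of_finite
    (f := fun p : Fin (K - 1) => B.α (lo p) - B.α (hi p))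
  unfold Δmin
  rw [← hp]
  exact sub_pos.2 (hα (lo_lt_hi p))

/-! ### Assembly of the bound -/

/-- The regret bound for small `δ`. -/
lemma regret_le_of_one_le_log [NeZero K] (hB : B.Assumptions)
    (hα : StrictAnti B.α) (hα_pos : ∀ i, 0 < B.α i) (hχ : 0 < χmin B)
    (R₀ : RankedList K) {δ : ℝ} (hδ0 : 0 < δ) (hδ1 : δ < 1) (hL : 1 ≤ Real.log (1 / δ))
    (hK : 2 ≤ K) (n : ℕ) :
    regret B δ R₀ n ≤
      180 * (K : ℝ) * (χmax B / χmin B)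
          * (((K : ℝ) - 1 + 2 * ((incorrectPairs R₀).card : ℝ)) / Δmin B)
          * Real.log (1 / δ)
        + δ ^ 2 * (K : ℝ) ^ 3 * (n : ℝ) ^ 2 := by
  classical
  set L := Real.log (1 / δ) with hLdef
  set V : ℝ := ((incorrectPairs R₀).card : ℝ) with hV
  have hΔ := Δmin_pos hα hK
  have hV0 : 0 ≤ V := Nat.cast_nonneg _
  have hK' : (2 : ℝ) ≤ K := by exact_mod_cast hK
  have hχmax : 0 ≤ χmax B := χ_nonneg _ _
  have hχmin1 : χmin B ≤ 1 := χ_le_one _ _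
  have hΔ1 : Δmin B ≤ 1 := by
    have h01 : (⟨0, by omega⟩ : Fin K) < ⟨1, by omega⟩ := by rw [Fin.lt_def]; norm_num
    have h1 := Δmin_le_gap (B := B) hα h01
    have h2 := α_le_one (B := B) ⟨0, by omega⟩
    have h3 := hα_pos ⟨1, by omega⟩
    linarith
  -- The factor 2 bounds α(i) + α(j) in the relative gap.
  set C : ℝ := (2 * L + 5) * (2 / Δmin B) with hCdef
  have hC : ∀ e ∈ ltPairs K, (2 * L + 5) / relGap B e ≤ C := by
    intro e he
    have helt : e.1 < e.2 := by simpa [ltPairs] using he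
    have hg := Δmin_le_gap (B := B) hα helt
    have h1 := α_le_one (B := B) e.1
    have h2 := α_le_one (B := B) e.2
    have h3 := hα_pos e.1
    have h4 := hα_pos e.2
    rw [hCdef, div_eq_mul_inv]
    refine mul_le_mul_of_nonneg_left ?_ (by linarith)
    rw [relGap, inv_div]
    exact div_le_div₀ (by norm_num) (by linarith) hΔ hg
  have hA := sum_integral_activeGap_le hB hα hα_pos R₀ hδ0 hδ1 (n + 1) hC (by positivity)
  have hD := integral_not_alive_le hB hα hα_pos hχ R₀ hδ0 hδ1 n
  set D := ∫ ω, (if Alive δ R₀ ω n then 0 else 1 : ℝ) ∂(experiment B) with hDdef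
  set h : ℕ → (ℕ → Outcome K) → ℝ := fun t ω => if Alive δ R₀ ω t then
    ∑ e ∈ ltPairs K, activeGap B δ (t + 1) (stateAfter δ R₀ ω t) e else 0 with hh
  have hA' : χmin B / 4 * ∑ t ∈ Finset.range (n + 1), ∫ ω, h t ω ∂(experiment B)
      ≤ C * ((K : ℝ) - 1 + 2 * V) := by
    rw [Finset.mul_sum]
    refine le_trans (le_of_eq (Finset.sum_congr rfl fun t _ => ?_)) hA
    rw [← integral_const_mul]
    congr 1
    ext ω
    simp only [hh]
    split_ifs <;> simp
  have hinth : ∀ t, Integrable (h t) (experiment B) := fun t => by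
    refine integrable_of_dependsOn_Iio (t := t) (fun ω ω' hω => ?_) _
    have h1 := stateAfter_dependsOn δ R₀ t hω
    have h2 := alive_dependsOn δ R₀ t hω
    simp only at h1 h2
    simp only [hh, h1, h2]
  have hintD : Integrable (fun ω => (if Alive δ R₀ ω n then 0 else 1 : ℝ)) (experiment B) := by
    refine integrable_of_dependsOn_Iio (t := n) (fun ω ω' hω => ?_) _
    have h2 := alive_dependsOn δ R₀ n hω
    simp only at h2
    simp only [h2]
  have hinth' : Integrable (fun ω => ∑ t ∈ Finset.range (n + 1), h t ω) (experiment B) :=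
    integrable_finsetSum _ fun t _ => hinth t
  have hmain : regret B δ R₀ n ≤ K * n * D + K * χmax B *
      (3 * ∑ t ∈ Finset.range (n + 1), ∫ ω, h t ω ∂(experiment B) + 2 * V) := by
    rw [regret_eq hB, ← integral_finsetSum _ fun t _ => integrable_regret_step δ R₀ t]
    have hint2 : Integrable (fun ω => 3 * ∑ t ∈ Finset.range (n + 1), h t ω + 2 * V)
        (experiment B) := (hinth'.const_mul 3).add (integrable_const _)
    refine (integral_mono (integrable_finsetSum _ fun t _ => integrable_regret_step δ R₀ t)
      ((hintD.const_mul (K * n)).add (hint2.const_mul (K * χmax B)))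
      fun ω => sum_regret_le hB hα).trans (le_of_eq ?_)
    simp only [Pi.add_apply]
    rw [integral_add (hintD.const_mul (K * n)) (hint2.const_mul (K * χmax B)),
      integral_const_mul, integral_const_mul, integral_add (hinth'.const_mul 3)
      (integrable_const _), integral_const_mul, integral_finsetSum _ fun t _ => hinth t]
    simp [hDdef]
  set M : ℝ := (K : ℝ) - 1 + 2 * V with hM
  have hM0 : 0 ≤ M := by rw [hM]; linarith
  have hH : ∑ t ∈ Finset.range (n + 1), ∫ ω, h t ω ∂(experiment B)
      ≤ 8 * (2 * L + 5) * (M / (χmin B * Δmin B)) := by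
    have : C * M = χmin B / 4 * (8 * (2 * L + 5) * (M / (χmin B * Δmin B))) := by
      rw [hCdef]; field_simp; ring
    rw [this] at hA'
    exact le_of_mul_le_mul_left hA' (by positivity)
  have hMV : 2 * V ≤ M / (χmin B * Δmin B) := by
    rw [le_div_iff₀ (by positivity)]
    have : χmin B * Δmin B ≤ 1 := mul_le_one₀ hχmin1 hΔ.le hΔ1
    nlinarith
  have hq : 0 ≤ M / (χmin B * Δmin B) := by positivity
  have hin : 3 * ∑ t ∈ Finset.range (n + 1), ∫ ω, h t ω ∂(experiment B) + 2 * V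
      ≤ 180 * L * (M / (χmin B * Δmin B)) := by
    -- The coefficient is 48L + 121, at most 180L because L ≥ 1.
    have : (24 * (2 * L + 5) + 1) * (M / (χmin B * Δmin B))
        ≤ 180 * L * (M / (χmin B * Δmin B)) :=
      mul_le_mul_of_nonneg_right (by linarith) hq
    linarith
  have hfin1 : K * χmax B * (3 * ∑ t ∈ Finset.range (n + 1), ∫ ω, h t ω ∂(experiment B) + 2 * V)
      ≤ 180 * (K : ℝ) * (χmax B / χmin B) * (M / Δmin B) * L := by
    refine (mul_le_mul_of_nonneg_left hin (by positivity)).trans (le_of_eq ?_)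
    field_simp
  have hfin2 : K * n * D ≤ δ ^ 2 * (K : ℝ) ^ 3 * (n : ℝ) ^ 2 := by
    refine (mul_le_mul_of_nonneg_left hD (by positivity)).trans (le_of_eq ?_)
    ring
  linarith

end BubbleRank

theorem theorem1 {K : ℕ} [NeZero K] (B : ClickBandit K) (hB : B.Assumptions)
    (hα : StrictAnti B.α) (hα_pos : ∀ i, 0 < B.α i) (hχ : 0 < BubbleRank.χmin B)
    (R₀ : RankedList K) (δ : ℝ) (hδ0 : 0 < δ) (hδ1 : δ < 1) (n : ℕ) :
    BubbleRank.regret B δ R₀ n ≤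
      180 * (K : ℝ) * (BubbleRank.χmax B / BubbleRank.χmin B)
          * (((K : ℝ) - 1 + 2 * ((BubbleRank.incorrectPairs R₀).card : ℝ)) / BubbleRank.Δmin B)
          * Real.log (1 / δ)
        + δ ^ (1 / 2 : ℝ) * (K : ℝ) ^ 3 * (n : ℝ) ^ 2 := by
  have hL0 : 0 < Real.log (1 / δ) := Real.log_pos (by rw [lt_div_iff₀ hδ0]; linarith)
  have hχmax : 0 ≤ BubbleRank.χmax B := BubbleRank.χ_nonneg _ _
  have hpow : 0 ≤ δ ^ (1 / 2 : ℝ) := Real.rpow_nonneg hδ0.le _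
  rcases Nat.lt_or_ge K 2 with hK | hK
  · obtain rfl : K = 1 := by have := NeZero.pos K; omega
    have h0 : BubbleRank.regret B δ R₀ n = 0 := by
      rw [BubbleRank.regret_eq hB]
      refine Finset.sum_eq_zero fun t _ => ?_
      have : ∀ ω, BubbleRank.displayed δ R₀ ω t = 1 := fun ω => Subsingleton.elim _ _
      simp [this]
    rw [h0]
    -- For K = 1 the infimum is over an empty family, so it is 0 and the quotient by it is 0 as
    -- well.
    have hΔ : BubbleRank.Δmin B = 0 := by
      unfold BubbleRank.Δmin
      have : IsEmpty (Fin (1 - 1)) := Fin.isEmpty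
      exact Real.iInf_of_isEmpty _
    rw [hΔ]
    simp only [div_zero, mul_zero, zero_mul, zero_add]
    positivity
  have hΔ := BubbleRank.Δmin_pos hα hK
  have hK' : (2 : ℝ) ≤ K := by exact_mod_cast hK
  rcases le_total 1 (Real.log (1 / δ)) with hL | hL
  · refine (BubbleRank.regret_le_of_one_le_log hB hα hα_pos hχ R₀ hδ0 hδ1 hL hK n).trans ?_
    have : δ ^ 2 ≤ δ ^ (1 / 2 : ℝ) := by
      rw [← Real.rpow_natCast]
      exact Real.rpow_le_rpow_of_exponent_ge hδ0 hδ1.le (by norm_num)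
    gcongr
  -- For δ ≥ 1/e the second term alone exceeds the trivial bound K n, since √δ ≥ 1/2 and K² ≥ 4.
  · refine (BubbleRank.regret_le_mul hB δ R₀ n).trans ?_
    have hM0 : 0 ≤ (K : ℝ) - 1 + 2 * ((BubbleRank.incorrectPairs R₀).card : ℝ) := by
      have : (0 : ℝ) ≤ ((BubbleRank.incorrectPairs R₀).card : ℝ) := Nat.cast_nonneg _
      linarith
    refine le_trans ?_ (le_add_of_nonneg_left (by positivity))
    have hδ : 1 / 2 ≤ δ ^ (1 / 2 : ℝ) := by
      have h1 : -1 ≤ Real.log δ := by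
        rw [one_div, Real.log_inv] at hL
        linarith
      rw [Real.rpow_def_of_pos hδ0]
      have := Real.add_one_le_exp (Real.log δ * (1 / 2))
      linarith
    have hn : (n : ℝ) ≤ (n : ℝ) ^ 2 := by
      rcases Nat.eq_zero_or_pos n with rfl | hn
      · simp
      · have : (1 : ℝ) ≤ n := by exact_mod_cast hn
        nlinarith
    have h1 : (1 : ℝ) ≤ δ ^ (1 / 2 : ℝ) * (K : ℝ) ^ 2 := by nlinarith
    calc (K : ℝ) * n ≤ K * (n : ℝ) ^ 2 := by gcongr
      _ = 1 * (K * (n : ℝ) ^ 2) := by ring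
      _ ≤ (δ ^ (1 / 2 : ℝ) * (K : ℝ) ^ 2) * (K * (n : ℝ) ^ 2) := by gcongr
      _ = δ ^ (1 / 2 : ℝ) * (K : ℝ) ^ 3 * (n : ℝ) ^ 2 := by ring
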